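/- **Setting.** A weighted election $E=(C,V,A,w,k)$ consists of finite sets $C$ of candidates and $V$ of voters, an approval set $A_v\subseteq C$ and a weight (stake) $w(v)\ge 0$ for every voter $v$, and a committee size $k$; $V_c=\{v: c\in A_v\}$ and $w(V')=\sum_{v\in V'}w(v)$. All rules below elect $k$ candidates $c_1,c_2,\dots,c_k$ one after the other; ties are broken by a fixed linear order on the candidates (smaller first). * *AV* elects in each round an unelected candidate $c$ maximizing $w(V_c)$. * *SAV* elects in each round an unelected candidate $c$ maximizing the SAV score $\sum_{v\in V_c} w(v)/|A_v|$. * *seq-Phragmén*: starting with no money at time $0$, every voter $v$ earns money at rate $w(v)$; as soon as the supporters of an unelected candidate jointly own one unit, that candidate is elected and the money of all its supporters is reset to $0$; this is repeated until $k$ candidates are elected. * *Phragmms* maintains the committee $W$ elected so far and a balanced vote assignment $\alpha$ for $W$. A vote assignment gives numbers $\alpha(v,c)\ge 0$ for $c\in W\cap A_v$ with $\sum_c\alpha(v,c)\le w(v)$; the backing weight of $c\in W$ is $b(c)=\sum_{v\in V_c}\alpha(v,c)$; $\alpha$ is balanced if it maximizes $\sum_{c\in W} b(c)$ and, subject to this,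 minimizes $\sum_{c\in W} b(c)^2$. The score of an unelected candidate $x$ is the largest $t\ge 0$ with $\sum_{v\in V_x}\bigl(w(v)-\sum_{c\in W\cap A_v}\alpha(v,c)\min\{1,t/b(c)\}\bigr)\ge t$ (terms with $\alpha(v,c)=0$ are $0$). In each round an unelected candidate of maximum score is elected, after which a balanced vote assignment for the enlarged committee is computed. An *$\ell$-replacement* $(C',V',A',w')$ consists of a set $C'$ of $\ell$ new candidates and a finite set $V'$ of new voters ($C\cap C'=V\cap V'=\emptyset$) with approval sets $A'_v\subseteq C'$ and weights $w'(v)\ge 0$. It is *successful* for a rule if all of $C'$ is contained in the committee that the rule selects in $(C\cup C',V\cup V',A\cup A',w\cup w',k)$, where ties between a new and an old candidate are broken in favour of the new one. The *minimum exogenous cost of an $\ell$-replacement* is the minimum of $w'(V')$ over all successful $\ell$-replacements. **Theorem.** Let $1\le \ell\le k$, and let $c_1,\dots,c_k$ be the candidates elected by the rule in question on $E$, in the order of their election (so $|C|\ge k$, and for seq-Phragmén all $k$ elections take place at finite times). Then the minimum exogenous cost of an $\ell$-replacement exists and equals 1. for AV: $x=w(V_{c_{k-\ell+1}})$; it is attained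 by one new voter of weight $x$ approving all $\ell$ new candidates; 2. for SAV: $\ell\cdot x$, where $x=\sum_{v\in V_{c_{k-\ell+1}}} w(v)/|A_v|$; it is attained by $\ell$ new voters of weight $x$ each, approving one distinct new candidate each; 3. for seq-Phragmén: $\ell/t$, where $t>0$ is the time at which $c_{k-\ell+1}$ is elected; it is attained by $\ell$ new voters of weight $1/t$ each, approving one distinct new candidate each; 4. for Phragmms: $z=\ell\cdot\min\{s_1,\dots,s_{k-\ell+1}\}$, where $s_i$ is the score of $c_i$ at the moment of its election; it is attained by one new voter of weight $z$ approving all $\ell$ new candidates, and also by $\ell$ new voters of weight $z/\ell$ each, approving one distinct new candidate each. In particular the minimum is computed in time $O(1)$ from $\ell$ and the stated datum ($x$, $x$, $t$, and $\min\{s_1,\dots,s_{k-\ell+1}\}$, respectively): for each rule there is a fixed straight-line program, independent of the election and of $\ell$, that computes it in at most three steps, where reading an input and one arithmetic operation count as one step each. -/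

import Mathlib

/-! Weighted approval-based committee elections, four sequential voting rules, and replacements of
committee members by new candidates supported by new voters. -/

universe u v

namespace ABCVoting

/-- A weighted approval-based election `(C, V, A, w, k)`. Weights are arbitrary nonnegative reals
(no normalisation). The tie-breaking priority of candidates is a linear order on `C`. -/
structure Election (C : Type u) (V : Type v) where
  /-- the committee size -/
  k : ℕ
  /-- the approval set of a voter -/
  approves : V → Finset C
  /-- the voting weight (stake) of a voter -/
  weight : V → ℝ
  weight_nonneg : ∀ v, 0 ≤ weight v

section Basic

variable {C : Type u} {V : Type v} [LinearOrder C] [Fintype V]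

/-- The supporters `V_c` of a candidate. -/
def Election.supporters (E : Election C V) (c : C) : Finset V :=
  Finset.univ.filter fun v => c ∈ E.approves v

/-- The approval weight `w(V_c)`. -/
noncomputable def Election.approvalWeight (E : Election C V) (c : C) : ℝ :=
  ∑ v ∈ E.supporters c, E.weight v

/-- The satisfaction approval score. -/
noncomputable def Election.savScore (E : Election C V) (c : C) : ℝ :=
  ∑ v ∈ E.supporters c, E.weight v / ((E.approves v).card : ℝ)

/-- The set of the first `i` candidates `c 0, …, c (i - 1)` of a selection sequence. -/
def electedSet (c : ℕ → C) (i : ℕ) : Finset C := (Finset.range i).image c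

/-- For `k` rounds, the sequence `c` selects in round `i` an unelected candidate of maximum score
(the scores may depend on the round), the smallest such candidate in case of ties. -/
def IsGreedyRun (k : ℕ) (score : ℕ → C → ℝ) (c : ℕ → C) : Prop :=
  ∀ i < k, c i ∉ electedSet c i ∧
    ∀ d, d ∉ electedSet c i →
      score i d < score i (c i) ∨ (score i d = score i (c i) ∧ c i ≤ d)

/-- Approval Voting selects `c 0, c 1, …, c (k - 1)` in this order. Only the first `k` terms of
the sequence matter, here and below. -/
def IsAVRun (E : Election C V) (c : ℕ → C) : Prop :=
  IsGreedyRun E.k (fun _ => E.approvalWeight) c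

/-- Satisfaction Approval Voting selects `c 0, c 1, …, c (k - 1)` in this order. -/
def IsSAVRun (E : Election C V) (c : ℕ → C) : Prop :=
  IsGreedyRun E.k (fun _ => E.savScore) c

/-! ### Phragmén's sequential rule -/

/-- The last moment at which the money of voter `v` was reset to zero (or `0`, the start), after
`c 0, …, c (i - 1)` have been elected at the times `t 0, …, t (i - 1)`. -/
def Election.lastReset (E : Election C V) (c : ℕ → C) (t : ℕ → ℝ) : ℕ → V → ℝ
  | 0, _ => 0
  | i + 1, v => if c i ∈ E.approves v then t i else E.lastReset c t i v

/-- The money that the supporters of `x` jointly own at time `s`, after the first `i` elections of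
the sequence: every voter earns `weight v` units per unit of time. -/
noncomputable def Election.supporterMoney (E : Election C V) (c : ℕ → C) (t : ℕ → ℝ)
    (i : ℕ) (s : ℝ) (x : C) : ℝ :=
  ∑ v ∈ E.supporters x, E.weight v * (s - E.lastReset c t i v)

/-- seq-Phragmén elects `c 0, …, c (k - 1)` in this order, at the times `t 0, …, t (k - 1)`:
in each round, as soon as the supporters of some unelected candidate jointly own one unit of
money, such a candidate (the smallest one in case of ties) is elected and the money of all its
supporters is reset to zero. -/
def IsSeqPhragmenRun (E : Election C V) (c : ℕ → C) (t : ℕ → ℝ) : Prop :=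
  ∀ i < E.k,
    IsLeast {s : ℝ | 0 ≤ s ∧ (∀ j < i, t j ≤ s) ∧
      ∃ x, x ∉ electedSet c i ∧ 1 ≤ E.supporterMoney c t i s x} (t i) ∧
    IsLeast {x : C | x ∉ electedSet c i ∧ 1 ≤ E.supporterMoney c t i (t i) x} (c i)

/-! ### Phragmms -/

/-- `α` is a vote assignment for the committee `W`. -/
structure Election.IsVoteAssignment (E : Election C V) (W : Finset C) (α : V → C → ℝ) : Prop where
  nonneg : ∀ v c, 0 ≤ α v c
  supported : ∀ v c, 0 < α v c → c ∈ W ∧ c ∈ E.approves v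
  le_weight : ∀ v, ∑ c ∈ W, α v c ≤ E.weight v

/-- The backing weight of `c` with respect to `α`. -/
def Election.backing (E : Election C V) (α : V → C → ℝ) (c : C) : ℝ :=
  ∑ v ∈ E.supporters c, α v c

/-- `α` is a balanced vote assignment for `W`: it maximises the sum of the backing weights and,
among the assignments which do so, it minimises the sum of the squared backing weights. -/
structure Election.IsBalanced (E : Election C V) (W : Finset C) (α : V → C → ℝ) : Prop where
  isVoteAssignment : E.IsVoteAssignment W α
  max_sum : ∀ β, E.IsVoteAssignment W β → ∑ c ∈ W, E.backing β c ≤ ∑ c ∈ W, E.backing α c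
  min_sq : ∀ β, E.IsVoteAssignment W β → ∑ c ∈ W, E.backing β c = ∑ c ∈ W, E.backing α c →
    ∑ c ∈ W, E.backing α c ^ 2 ≤ ∑ c ∈ W, E.backing β c ^ 2

/-- The part of the weight of voter `v` that is free, or becomes free when the backing weight of
every member of `W` that exceeds `t` is scaled down to `t`. (A member with backing weight `0` has
`α v c = 0`, so the value of the quotient is irrelevant there.) -/
noncomputable def Election.slack (E : Election C V) (W : Finset C) (α : V → C → ℝ) (v : V)
    (t : ℝ) : ℝ :=
  E.weight v - ∑ c ∈ W, α v c * min 1 (t / E.backing α c)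

/-- The backing weight that the candidate `x` can receive by local changes of `α` which do not
decrease the backing weight of any member of `W` below `t` (or below its old value). -/
noncomputable def Election.prescore (E : Election C V) (W : Finset C) (α : V → C → ℝ) (x : C)
    (t : ℝ) : ℝ :=
  ∑ v ∈ E.supporters x, E.slack W α v t

/-- The Phragmms score of a candidate `x` outside `W`: the largest `t` such that `x` can be given
backing weight `t` in this way. The supremum is attained, see `isGreatest_phragmmsScore`. -/
noncomputable def Election.phragmmsScore (E : Election C V) (W : Finset C) (α : V → C → ℝ)
    (x : C) : ℝ :=
  sSup {t : ℝ | 0 ≤ t ∧ t ≤ E.prescore W α x t}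

/-- Phragmms selects `c 0, …, c (k - 1)` in this order, where `α i` is the (balanced) vote
assignment for the first `i` selected candidates with which round `i` starts. -/
def IsPhragmmsRun (E : Election C V) (c : ℕ → C) (α : ℕ → V → C → ℝ) : Prop :=
  (∀ i < E.k, E.IsBalanced (electedSet c i) (α i)) ∧
    IsGreedyRun E.k (fun i => E.phragmmsScore (electedSet c i) (α i)) c

/-- The score `s_{i+1}` of the candidate `c i` at the moment of its selection by Phragmms. -/
noncomputable def Election.electionScore (E : Election C V) (c : ℕ → C) (α : ℕ → V → C → ℝ)
    (i : ℕ) : ℝ :=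
  E.phragmmsScore (electedSet c i) (α i) (c i)

theorem Election.isGreatest_phragmmsScore (E : Election C V) {W : Finset C} {α : V → C → ℝ}
    (hα : E.IsVoteAssignment W α) (x : C) :
    IsGreatest {t : ℝ | 0 ≤ t ∧ t ≤ E.prescore W α x t} (E.phragmmsScore W α x) := by
  have hb : ∀ c, 0 ≤ E.backing α c := fun c => Finset.sum_nonneg fun v _ => hα.nonneg v c
  have hcont : Continuous (E.prescore W α x) := by
    unfold Election.prescore Election.slack
    fun_prop
  have hclosed : IsClosed {t : ℝ | 0 ≤ t ∧ t ≤ E.prescore W α x t} :=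
    (isClosed_le continuous_const continuous_id).inter (isClosed_le continuous_id hcont)
  have hne : ({t : ℝ | 0 ≤ t ∧ t ≤ E.prescore W α x t}).Nonempty := by
    refine ⟨0, le_refl _, Finset.sum_nonneg fun v _ => ?_⟩
    simpa [Election.slack] using E.weight_nonneg v
  have hbdd : BddAbove {t : ℝ | 0 ≤ t ∧ t ≤ E.prescore W α x t} := by
    refine ⟨∑ v ∈ E.supporters x, E.weight v, fun t ht => ht.2.trans ?_⟩
    refine Finset.sum_le_sum fun v _ => sub_le_self _ (Finset.sum_nonneg fun c _ => ?_)
    exact mul_nonneg (hα.nonneg v c) (le_min zero_le_one (div_nonneg ht.1 (hb c)))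
  exact ⟨hclosed.csSup_mem hne hbdd, fun t ht => le_csSup hbdd ht⟩

end Basic

/-! ### Voting rules as relations between elections and committees -/

set_option linter.checkUnivs false in
/-- A voting rule; `rule C V E W` says that `W` is the committee selected for the election `E`
with candidate set `C` and voter set `V`. -/
abbrev Rule : Type (max (u + 1) (v + 1)) :=
  ∀ (C : Type u) (V : Type v) [LinearOrder C] [Fintype V], Election C V → Finset C → Prop

/-- Approval Voting. -/
def AV : Rule.{u, v} := fun _ _ _ _ E W => ∃ c, IsAVRun E c ∧ W = electedSet c E.k

/-- Satisfaction Approval Voting. -/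
def SAV : Rule.{u, v} := fun _ _ _ _ E W => ∃ c, IsSAVRun E c ∧ W = electedSet c E.k

/-- Phragmén's sequential rule. -/
def SeqPhragmen : Rule.{u, v} := fun _ _ _ _ E W =>
  ∃ c t, IsSeqPhragmenRun E c t ∧ W = electedSet c E.k

/-- Phragmms. -/
def Phragmms : Rule.{u, v} := fun _ _ _ _ E W =>
  ∃ c α, IsPhragmmsRun E c α ∧ W = electedSet c E.k

/-! ### Replacements -/

/-- An `ℓ`-replacement `(C', V', A', w')`: `ℓ` new candidates, labelled by `Fin ℓ`, and finitely
many weighted new voters who approve new candidates. -/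
structure Replacement (ℓ : ℕ) where
  /-- the number of new voters -/
  n : ℕ
  /-- the approval sets of the new voters -/
  approves : Fin n → Finset (Fin ℓ)
  /-- the weights of the new voters -/
  weight : Fin n → ℝ
  weight_nonneg : ∀ v, 0 ≤ weight v

/-- The total weight `w'(V')` of a replacement. -/
def Replacement.totalWeight {ℓ : ℕ} (R : Replacement ℓ) : ℝ := ∑ v, R.weight v

/-- The disjoint union of `ℓ` new candidates and the candidates in `C`. Its order puts every new
candidate before every old one: ties between new and old candidates are broken in favour of the
new ones, and ties within either group as before. -/
abbrev ExtCand (ℓ : ℕ) (C : Type u) : Type u := Lex (Fin ℓ ⊕ C)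

/-- A new candidate, as a candidate of the extended election. -/
def newCand (ℓ : ℕ) (C : Type u) : Fin ℓ ↪ ExtCand ℓ C :=
  Function.Embedding.inl.trans toLex.toEmbedding

/-- An old candidate, as a candidate of the extended election. -/
def oldCand (ℓ : ℕ) (C : Type u) : C ↪ ExtCand ℓ C :=
  Function.Embedding.inr.trans toLex.toEmbedding

/-- The extended election `(C ∪ C', V ∪ V', A ∪ A', w ∪ w', k)`. -/
def Election.extend {C : Type u} {V : Type v} (E : Election C V) {ℓ : ℕ} (R : Replacement ℓ) :
    Election (ExtCand ℓ C) (Fin R.n ⊕ V) where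
  k := E.k
  approves := Sum.elim (fun v => (R.approves v).map (newCand ℓ C))
    (fun v => (E.approves v).map (oldCand ℓ C))
  weight := Sum.elim R.weight E.weight
  weight_nonneg := by
    rintro (v | v)
    · exact R.weight_nonneg v
    · exact E.weight_nonneg v

/-- The replacement is successful: the committee selected for the extended election contains all
new candidates. -/
def Replacement.Successful {ℓ : ℕ} (R : Replacement ℓ) (rule : Rule.{u, v}) {C : Type u}
    {V : Type v} [LinearOrder C] [Fintype V] (E : Election C V) : Prop :=
  ∃ W : Finset (ExtCand ℓ C), rule (ExtCand ℓ C) (Fin R.n ⊕ V) (E.extend R) W ∧ ∀ i, newCand ℓ C i ∈ W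

/-- `x` is the minimum exogenous cost of an `ℓ`-replacement: the minimum (which in particular is
attained) of the total weights of the successful `ℓ`-replacements. -/
def IsMinExogenousCost (rule : Rule.{u, v}) {C : Type u} {V : Type v} [LinearOrder C] [Fintype V]
    (E : Election C V) (ℓ : ℕ) (x : ℝ) : Prop :=
  IsLeast {y : ℝ | ∃ R : Replacement ℓ, R.Successful rule E ∧ R.totalWeight = y} x

/-- The replacement with a single voter, of weight `x`, who approves all `ℓ` new candidates. -/
def Replacement.oneVoter (ℓ : ℕ) (x : ℝ) (hx : 0 ≤ x) : Replacement ℓ where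
  n := 1
  approves := fun _ => Finset.univ
  weight := fun _ => x
  weight_nonneg := fun _ => hx

/-- The replacement with `ℓ` voters of weight `x` each, who approve one distinct new candidate
each. -/
def Replacement.oneVoterEach (ℓ : ℕ) (x : ℝ) (hx : 0 ≤ x) : Replacement ℓ where
  n := ℓ
  approves := fun i => {i}
  weight := fun _ => x
  weight_nonneg := fun _ => hx

/-! ### Constant-time computations -/

/-- Straight-line arithmetic programs over the reals with `n` inputs. -/
inductive ArithProgram (n : ℕ) : Type
  | input (i : Fin n) : ArithProgram n
  | add (p q : ArithProgram n) : ArithProgram n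
  | sub (p q : ArithProgram n) : ArithProgram n
  | mul (p q : ArithProgram n) : ArithProgram n
  | div (p q : ArithProgram n) : ArithProgram n

/-- The output of a program. -/
noncomputable def ArithProgram.eval {n : ℕ} (d : Fin n → ℝ) : ArithProgram n → ℝ
  | .input i => d i
  | .add p q => p.eval d + q.eval d
  | .sub p q => p.eval d - q.eval d
  | .mul p q => p.eval d * q.eval d
  | .div p q => p.eval d / q.eval d

/-- The number of steps of a program: reading an input and an arithmetic operation cost one step
each. -/
def ArithProgram.steps {n : ℕ} : ArithProgram n → ℕ
  | .input _ => 1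
  | .add p q => p.steps + q.steps + 1
  | .sub p q => p.steps + q.steps + 1
  | .mul p q => p.steps + q.steps + 1
  | .div p q => p.steps + q.steps + 1

end ABCVoting

open ABCVoting

/-! New voters approve only new candidates and old voters only old ones, so the two groups do not
interact. In the extended election the old candidates are therefore elected in their original order,
with new ones interleaved (`IsGreedyRun.follows`, `IsPartialPhragmenRun.follows`). With indices
starting at `0`, all `ℓ` new candidates are elected iff exactly `k - ℓ` old ones are, that is, iff
`c (k - ℓ)` is not reached.

Sufficiency: if a new candidate were missing, each of `c 0, …, c (k - ℓ)` would have won a round in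
which the new candidate was available. The stated replacements make it at least tie with one of
them, and it wins ties.

Lower bounds: while new candidates are being elected, some `c j` with `j ≤ k - ℓ` is still
competing. For AV and SAV this forces the score of every new candidate up to that of `c (k - ℓ)`,
and scores are bounded by weight. For seq-Phragmén it forces all new elections to take place by time
`t (k - ℓ)`, while the new voters have to pay `ℓ` units of money. For Phragmms it forces every
round's winning score to be at least the minimum `m`; then some vote assignment backs every member
with at least `m` (`IsPhragmmsRun.exists_le_backing`), and the `ℓ` new members draw `ℓ * m` from new
voters only.

Phragmms needs a further fact: a balanced assignment is not unique, but its backing weights and the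
scores are. Both follow from the first-order conditions `Election.IsLocallyBalanced`, which also
restrict from the extended election to the old one. -/

namespace ABCVoting

/-! ### Selection sequences and existence of greedy runs -/

section Sequences

variable {C : Type u} [LinearOrder C]

theorem mem_electedSet {c : ℕ → C} {i : ℕ} {x : C} :
    x ∈ electedSet c i ↔ ∃ j < i, c j = x := by
  simp [electedSet]

theorem electedSet_zero (c : ℕ → C) : electedSet c 0 = ∅ := by
  simp [electedSet]

theorem electedSet_succ (c : ℕ → C) (i : ℕ) :
    electedSet c (i + 1) = insert (c i) (electedSet c i) := by
  simp [electedSet, Finset.range_add_one]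

theorem electedSet_congr {c c' : ℕ → C} {i : ℕ} (h : ∀ j < i, c j = c' j) :
    electedSet c i = electedSet c' i := by
  ext x
  simp only [mem_electedSet]
  exact exists_congr fun j => and_congr_right fun hj => by rw [h j hj]

theorem electedSet_mono (c : ℕ → C) {i j : ℕ} (h : i ≤ j) : electedSet c i ⊆ electedSet c j := by
  intro x
  simp only [mem_electedSet]
  rintro ⟨a, ha, rfl⟩
  exact ⟨a, ha.trans_le h, rfl⟩

theorem card_electedSet_le (c : ℕ → C) (i : ℕ) : (electedSet c i).card ≤ i := by
  simpa [electedSet] using Finset.card_image_le (s := Finset.range i) (f := c)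

theorem card_electedSet {c : ℕ → C} {k : ℕ} (h : ∀ i < k, c i ∉ electedSet c i) :
    (electedSet c k).card = k := by
  induction k with
  | zero => simp [electedSet_zero]
  | succ k ih =>
    rw [electedSet_succ, Finset.card_insert_of_notMem (h k (by omega)),
      ih fun i hi => h i (by omega)]

theorem notMem_electedSet {c : ℕ → C} {k : ℕ} (h : ∀ i < k, c i ∉ electedSet c i) {i j : ℕ}
    (hij : i ≤ j) (hj : j < k) : c j ∉ electedSet c i :=
  fun hc => h j hj (electedSet_mono c hij hc)

/-- The elected sets of a sequence which is defined by recursion on the elected set. -/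
theorem exists_electedSet_recursion (next : Finset C → C) :
    ∃ c : ℕ → C, ∀ i, c i = next (electedSet c i) := by
  let W : ℕ → Finset C := fun i => Nat.rec ∅ (fun _ W => insert (next W) W) i
  refine ⟨fun i => next (W i), fun i => congrArg next ?_⟩
  induction i with
  | zero => rw [electedSet_zero]; rfl
  | succ i ih => rw [electedSet_succ, ← ih]

theorem exists_isGreedyRun [Finite C] [Nonempty C] {k : ℕ} (hk : k ≤ Nat.card C)
    (score : Finset C → C → ℝ) :
    ∃ c, IsGreedyRun k (fun i => score (electedSet c i)) c := by
  have := Fintype.ofFinite C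
  have step : ∀ W : Finset C, ∃ x, W.card < Nat.card C → x ∉ W ∧
      ∀ d, d ∉ W → score W d < score W x ∨ (score W d = score W x ∧ x ≤ d) := by
    intro W
    by_cases hW : W.card < Nat.card C
    · have hne : (Wᶜ).Nonempty := by
        rw [← Finset.card_pos, Finset.card_compl, ← Nat.card_eq_fintype_card]
        omega
      -- A lexicographic maximum of score and reversed candidate order builds in the tie-breaking.
      obtain ⟨x, hx, hmax⟩ := Finset.exists_max_image Wᶜ
        (fun x => toLex (score W x, OrderDual.toDual x)) hne
      refine ⟨x, fun _ => ⟨by simpa using hx, fun d hd => ?_⟩⟩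
      simpa [Prod.Lex.le_iff] using hmax d (by simpa using hd)
    · exact ⟨Classical.arbitrary C, fun h => absurd h hW⟩
  choose next hnext using step
  obtain ⟨c, hc⟩ := exists_electedSet_recursion next
  refine ⟨c, fun i hi => ?_⟩
  have := hnext (electedSet c i) (((card_electedSet_le c i).trans_lt hi).trans_le hk)
  rw [← hc] at this
  exact this

end Sequences

/-! ### Interleaving of old and new candidates in the extended election -/

section Extension

variable {C : Type u} {ℓ : ℕ}

instance [Finite C] : Finite (ExtCand ℓ C) := inferInstanceAs (Finite (Fin ℓ ⊕ C))

theorem eq_newCand_or_eq_oldCand (x : ExtCand ℓ C) :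
    (∃ z, x = newCand ℓ C z) ∨ ∃ y, x = oldCand ℓ C y := by
  rcases h : ofLex x with z | y
  · exact Or.inl ⟨z, h⟩
  · exact Or.inr ⟨y, h⟩

theorem newCand_ne_oldCand (z : Fin ℓ) (y : C) : newCand ℓ C z ≠ oldCand ℓ C y :=
  fun h => Sum.inl_ne_inr (toLex.injective h)

/-- The number of old candidates among the first `i` candidates of a sequence. -/
def oldCount (d : ℕ → ExtCand ℓ C) : ℕ → ℕ
  | 0 => 0
  | i + 1 => oldCount d i + Sum.elim (fun _ => 0) (fun _ => 1) (ofLex (d i))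

theorem oldCount_succ_of_new {d : ℕ → ExtCand ℓ C} {i : ℕ} {z : Fin ℓ}
    (h : d i = newCand ℓ C z) : oldCount d (i + 1) = oldCount d i := by
  rw [oldCount, h]; rfl

theorem oldCount_succ_of_old {d : ℕ → ExtCand ℓ C} {i : ℕ} {y : C}
    (h : d i = oldCand ℓ C y) : oldCount d (i + 1) = oldCount d i + 1 := by
  rw [oldCount, h]; rfl

theorem oldCount_mono (d : ℕ → ExtCand ℓ C) : Monotone (oldCount d) :=
  monotone_nat_of_le_succ fun _ => Nat.le_add_right _ _

theorem oldCount_le (d : ℕ → ExtCand ℓ C) (i : ℕ) : oldCount d i ≤ i := by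
  induction i with
  | zero => exact le_rfl
  | succ i ih =>
    rcases eq_newCand_or_eq_oldCand (d i) with ⟨z, h⟩ | ⟨y, h⟩
    · rw [oldCount_succ_of_new h]; omega
    · rw [oldCount_succ_of_old h]; omega

theorem exists_eq_oldCand_of_lt_oldCount {d : ℕ → ExtCand ℓ C} {p n : ℕ}
    (h : p < oldCount d n) : ∃ i < n, oldCount d i = p ∧ ∃ y, d i = oldCand ℓ C y := by
  induction n with
  | zero => exact absurd h (Nat.not_lt_zero _)
  | succ n ih =>
    by_cases hp : p < oldCount d n
    · obtain ⟨i, hi, h⟩ := ih hp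
      exact ⟨i, by omega, h⟩
    · rcases eq_newCand_or_eq_oldCand (d n) with ⟨z, hz⟩ | ⟨y, hy⟩
      · rw [oldCount_succ_of_new hz] at h; omega
      · rw [oldCount_succ_of_old hy] at h
        exact ⟨n, by omega, by omega, y, hy⟩

/-- In the first `n` rounds, the sequence `d` selects old candidates in the same order as `c`. -/
def Follows (d : ℕ → ExtCand ℓ C) (c : ℕ → C) (n : ℕ) : Prop :=
  ∀ i < n, ∀ y, d i = oldCand ℓ C y → y = c (oldCount d i)

theorem Follows.mono {d : ℕ → ExtCand ℓ C} {c : ℕ → C} {m n : ℕ} (h : Follows d c n)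
    (hmn : m ≤ n) : Follows d c m :=
  fun i hi => h i (hi.trans_le hmn)

theorem Follows.exists_eq {d : ℕ → ExtCand ℓ C} {c : ℕ → C} {p n : ℕ} (h : Follows d c n)
    (hp : p < oldCount d n) : ∃ i < n, oldCount d i = p ∧ d i = oldCand ℓ C (c p) := by
  obtain ⟨i, hi, ho, y, hy⟩ := exists_eq_oldCand_of_lt_oldCount hp
  exact ⟨i, hi, ho, by rw [hy, h i hi y hy, ho]⟩

theorem oldCand_notMem_approves_inl {V : Type v} (E : Election C V) (R : Replacement ℓ) (y : C) (v : Fin R.n) :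
    oldCand ℓ C y ∉ (E.extend R).approves (Sum.inl v) := by
  simp [Election.extend, newCand_ne_oldCand]

theorem newCand_notMem_approves_inr {V : Type v} (E : Election C V) (R : Replacement ℓ) (z : Fin ℓ) (v : V) :
    newCand ℓ C z ∉ (E.extend R).approves (Sum.inr v) := by
  simp [Election.extend, (newCand_ne_oldCand _ _).symm]

theorem oldCand_mem_approves_inr {V : Type v} (E : Election C V) (R : Replacement ℓ) (y : C) (v : V) :
    oldCand ℓ C y ∈ (E.extend R).approves (Sum.inr v) ↔ y ∈ E.approves v := by
  simp [Election.extend]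

theorem newCand_mem_approves_inl {V : Type v} (E : Election C V) (R : Replacement ℓ) (z : Fin ℓ)
    (v : Fin R.n) :
    newCand ℓ C z ∈ (E.extend R).approves (Sum.inl v) ↔ z ∈ R.approves v := by
  simp [Election.extend]

theorem totalWeight_oneVoter (x : ℝ) (hx : 0 ≤ x) :
    (Replacement.oneVoter ℓ x hx).totalWeight = x := by
  change ∑ _v : Fin 1, x = x
  simp

theorem totalWeight_oneVoterEach (x : ℝ) (hx : 0 ≤ x) :
    (Replacement.oneVoterEach ℓ x hx).totalWeight = ℓ * x := by
  change ∑ _v : Fin ℓ, x = ℓ * x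
  simp

variable [LinearOrder C]

theorem newCand_lt_oldCand (z : Fin ℓ) (y : C) : newCand ℓ C z < oldCand ℓ C y :=
  Sum.Lex.inl_lt_inr z y

theorem oldCand_le_oldCand {y y' : C} : oldCand ℓ C y ≤ oldCand ℓ C y' ↔ y ≤ y' :=
  Sum.Lex.inr_le_inr_iff

/-- Each round adds either one old candidate or one fresh new one. This turns success of a
replacement into a count of old winners. -/
theorem oldCount_add_card {d : ℕ → ExtCand ℓ C} {n : ℕ} (h : ∀ i < n, d i ∉ electedSet d i) :
    oldCount d n + (Finset.univ.filter fun z => newCand ℓ C z ∈ electedSet d n).card = n := by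
  induction n with
  | zero => simp [oldCount, electedSet_zero]
  | succ n ih =>
    have ih := ih fun i hi => h i (by omega)
    rcases eq_newCand_or_eq_oldCand (d n) with ⟨z, hz⟩ | ⟨y, hy⟩
    · have hn : newCand ℓ C z ∉ electedSet d n := hz ▸ h n (by omega)
      have : (Finset.univ.filter fun z' => newCand ℓ C z' ∈ electedSet d (n + 1)) =
          insert z (Finset.univ.filter fun z' => newCand ℓ C z' ∈ electedSet d n) := by
        ext z'
        simp [electedSet_succ, hz]
      rw [oldCount_succ_of_new hz, this, Finset.card_insert_of_notMem (by simpa using hn)]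
      omega
    · have : (Finset.univ.filter fun z' => newCand ℓ C z' ∈ electedSet d (n + 1)) =
          (Finset.univ.filter fun z' => newCand ℓ C z' ∈ electedSet d n) := by
        ext z'
        simp [electedSet_succ, hy, newCand_ne_oldCand]
      rw [oldCount_succ_of_old hy, this]
      omega

theorem oldCount_eq_of_forall_mem {d : ℕ → ExtCand ℓ C} {n : ℕ}
    (h : ∀ i < n, d i ∉ electedSet d i) (hmem : ∀ z, newCand ℓ C z ∈ electedSet d n) :
    oldCount d n = n - ℓ := by
  have := oldCount_add_card h
  simp only [hmem, Finset.filter_true, Finset.card_univ, Fintype.card_fin] at this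
  omega

theorem lt_oldCount_of_notMem {d : ℕ → ExtCand ℓ C} {n : ℕ} (hn : ℓ ≤ n)
    (h : ∀ i < n, d i ∉ electedSet d i) {z : Fin ℓ} (hz : newCand ℓ C z ∉ electedSet d n) :
    n - ℓ < oldCount d n := by
  have := oldCount_add_card h
  have hlt : (Finset.univ.filter fun z => newCand ℓ C z ∈ electedSet d n).card < ℓ := by
    conv_rhs => rw [← Fintype.card_fin ℓ]
    exact Finset.card_lt_univ_of_notMem (x := z) (by simpa using hz)
  omega

theorem Follows.mem_iff {d : ℕ → ExtCand ℓ C} {c : ℕ → C} {n : ℕ} (h : Follows d c n) (y : C) :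
    oldCand ℓ C y ∈ electedSet d n ↔ y ∈ electedSet c (oldCount d n) := by
  induction n with
  | zero => simp [electedSet_zero, oldCount]
  | succ n ih =>
    have ih := ih (h.mono (Nat.le_succ n))
    rcases eq_newCand_or_eq_oldCand (d n) with ⟨z, hz⟩ | ⟨y', hy⟩
    · simp [oldCount_succ_of_new hz, electedSet_succ, hz, ih, (newCand_ne_oldCand z y).symm]
    · rw [oldCount_succ_of_old hy, electedSet_succ, electedSet_succ, hy, ← h n (by omega) y' hy]
      simp [ih]

theorem Follows.oldCand_notMem {d : ℕ → ExtCand ℓ C} {c : ℕ → C} {i j k : ℕ}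
    (h : Follows d c i) (hc : ∀ i < k, c i ∉ electedSet c i) (hj : j < k)
    (hij : oldCount d i ≤ j) : oldCand ℓ C (c j) ∉ electedSet d i := by
  rw [h.mem_iff]
  exact notMem_electedSet hc hij hj

/-- While the old winners so far form a prefix of `c`, both runs see the same unelected old
candidates with the same scores. If `d` picks an old one, it and the next term of `c` each beat or
tie the other, and the common tie-breaking order makes them equal. -/
theorem IsGreedyRun.follows {k : ℕ} {S : ℕ → ExtCand ℓ C → ℝ} {s : ℕ → C → ℝ}
    {d : ℕ → ExtCand ℓ C} {c : ℕ → C} (hd : IsGreedyRun k S d) (hc : IsGreedyRun k s c)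
    (hS : ∀ i < k, Follows d c i → ∀ y, S i (oldCand ℓ C y) = s (oldCount d i) y) :
    Follows d c k := by
  suffices ∀ n ≤ k, Follows d c n from this k le_rfl
  intro n
  induction n with
  | zero => exact fun _ i hi => absurd hi (Nat.not_lt_zero i)
  | succ n ih =>
    intro hn i hi y hy
    have hf := ih (by omega)
    rcases Nat.lt_succ_iff_lt_or_eq.1 hi with hi | rfl
    · exact hf i hi y hy
    have hSi := hS i (by omega) hf
    have hoi : oldCount d i < k := (oldCount_le d i).trans_lt (by omega)
    obtain ⟨hdi, hdmax⟩ := hd i (by omega)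
    obtain ⟨hci, hcmax⟩ := hc _ hoi
    rw [hy, hf.mem_iff] at hdi
    have h1 := hcmax y hdi
    have h2 := hdmax (oldCand ℓ C (c (oldCount d i))) (by rwa [hf.mem_iff])
    rw [hy, hSi, hSi, oldCand_le_oldCand] at h2
    rcases h1 with h1 | ⟨h1, h1'⟩ <;> rcases h2 with h2 | ⟨h2, h2'⟩
    · exact absurd h1 h2.not_gt
    · exact absurd h2 h1.ne'
    · exact absurd h1 h2.ne'
    · exact le_antisymm h2' h1'

/-- A new candidate whose score is never below `x` is elected if some old candidate among the
first `k - ℓ + 1` ones is elected with score `x`. -/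
theorem IsGreedyRun.newCand_mem {k : ℕ} {S : ℕ → ExtCand ℓ C → ℝ} {d : ℕ → ExtCand ℓ C}
    {c : ℕ → C} (hd : IsGreedyRun k S d) (hf : Follows d c k) (hℓ : ℓ ≤ k) {p : ℕ}
    (hp : p ≤ k - ℓ) {x : ℝ}
    (hold : ∀ i < k, oldCount d i = p → S i (oldCand ℓ C (c p)) ≤ x)
    (hnew : ∀ i < k, ∀ z, newCand ℓ C z ∉ electedSet d i → x ≤ S i (newCand ℓ C z)) (z : Fin ℓ) :
    newCand ℓ C z ∈ electedSet d k := by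
  by_contra hz
  -- A missing new candidate leaves more than `k - ℓ` seats to old ones, so `c p` wins some round
  -- `i`.
  obtain ⟨i, hi, ho, hdi⟩ := hf.exists_eq
    (hp.trans_lt (lt_oldCount_of_notMem hℓ (fun i hi => (hd i hi).1) hz))
  have hz' : newCand ℓ C z ∉ electedSet d i := fun h => hz (electedSet_mono d hi.le h)
  have h := (hd i hi).2 _ hz'
  rw [hdi] at h
  have h1 := hold i hi ho
  have h2 := hnew i hi z hz'
  rcases h with h | ⟨-, h⟩
  · linarith
  -- With equal scores, the priority of new candidates excludes a win of `c p`.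
  · exact absurd h (newCand_lt_oldCand z _).not_ge

theorem le_card_extCand [Finite C] {c : ℕ → C} {k : ℕ} (h : ∀ i < k, c i ∉ electedSet c i) :
    k ≤ Nat.card (ExtCand ℓ C) := by
  have := Fintype.ofFinite (ExtCand ℓ C)
  rw [Nat.card_eq_fintype_card, ← card_electedSet h, ← Finset.card_map (oldCand ℓ C)]
  exact Finset.card_le_univ _

/-! ### Supporters in the extended election -/

variable {V : Type v} [Fintype V]

theorem mem_supporters {E : Election C V} {c : C} {v : V} :
    v ∈ E.supporters c ↔ c ∈ E.approves v := by
  simp [Election.supporters]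

theorem supporters_extend_oldCand (E : Election C V) (R : Replacement ℓ) (y : C) :
    (E.extend R).supporters (oldCand ℓ C y) =
      (E.supporters y).map (Function.Embedding.inr : V ↪ Fin R.n ⊕ V) := by
  ext v
  rcases v with v | v
  · simp [mem_supporters, oldCand_notMem_approves_inl]
  · simp [mem_supporters, oldCand_mem_approves_inr]

theorem supporters_extend_newCand (E : Election C V) (R : Replacement ℓ) (z : Fin ℓ) :
    (E.extend R).supporters (newCand ℓ C z) =
      (Finset.univ.filter fun v => z ∈ R.approves v).map
        (Function.Embedding.inl : Fin R.n ↪ Fin R.n ⊕ V) := by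
  ext v
  rcases v with v | v
  · simp [mem_supporters, newCand_mem_approves_inl]
  · simp [mem_supporters, newCand_notMem_approves_inr]

theorem sum_supporters_extend_oldCand (E : Election C V) (R : Replacement ℓ) (y : C)
    (f : Fin R.n ⊕ V → ℝ) :
    ∑ v ∈ (E.extend R).supporters (oldCand ℓ C y), f v = ∑ v ∈ E.supporters y, f (Sum.inr v) := by
  rw [supporters_extend_oldCand, Finset.sum_map]
  rfl

theorem sum_supporters_extend_newCand (E : Election C V) (R : Replacement ℓ) (z : Fin ℓ)
    (f : Fin R.n ⊕ V → ℝ) :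
    ∑ v ∈ (E.extend R).supporters (newCand ℓ C z), f v =
      ∑ v with z ∈ R.approves v, f (Sum.inl v) := by
  rw [supporters_extend_newCand, Finset.sum_map]
  rfl

theorem sum_supporters_oneVoter (E : Election C V) {x : ℝ} (hx : 0 ≤ x) (z : Fin ℓ)
    (f : Fin (Replacement.oneVoter ℓ x hx).n ⊕ V → ℝ) :
    ∑ v ∈ (E.extend (Replacement.oneVoter ℓ x hx)).supporters (newCand ℓ C z), f v =
      f (Sum.inl (0 : Fin 1)) := by
  refine (sum_supporters_extend_newCand E _ z f).trans ?_
  change ∑ v : Fin 1 with z ∈ Finset.univ, f (Sum.inl v) = _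
  simp

theorem sum_supporters_oneVoterEach (E : Election C V) {x : ℝ} (hx : 0 ≤ x) (z : Fin ℓ)
    (f : Fin (Replacement.oneVoterEach ℓ x hx).n ⊕ V → ℝ) :
    ∑ v ∈ (E.extend (Replacement.oneVoterEach ℓ x hx)).supporters (newCand ℓ C z), f v =
      f (Sum.inl z) := by
  refine (sum_supporters_extend_newCand E _ z f).trans ?_
  change ∑ v : Fin ℓ with z ∈ ({v} : Finset (Fin ℓ)), f (Sum.inl v) = _
  simp [Finset.filter_eq]

end Extension

/-! ### AV and SAV: scores independent of the round -/

section StaticScores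

variable {C : Type u} {V : Type v} [LinearOrder C] [Fintype V] {ℓ : ℕ}

theorem exists_static_run [Finite C] {score : C → ℝ} {k : ℕ} {c : ℕ → C}
    (hc : IsGreedyRun k (fun _ => score) c) (S : ExtCand ℓ C → ℝ) :
    ∃ d, IsGreedyRun k (fun _ => S) d := by
  have : Nonempty (ExtCand ℓ C) := ⟨oldCand ℓ C (c 0)⟩
  exact exists_isGreedyRun (le_card_extCand fun i hi => (hc i hi).1) fun _ => S

/-- In an extended election whose rule elects candidates by scores independent of the round, each
new committee member has at least the score of the `(k - ℓ + 1)`-st old one. -/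
theorem IsGreedyRun.le_score_newCand {score : C → ℝ} {k : ℕ} {c : ℕ → C}
    (hc : IsGreedyRun k (fun _ => score) c) {S : ExtCand ℓ C → ℝ} {d : ℕ → ExtCand ℓ C}
    (hd : IsGreedyRun k (fun _ => S) d) (hS : ∀ y, S (oldCand ℓ C y) = score y)
    (hℓ : 1 ≤ ℓ) (hℓk : ℓ ≤ k) (hmem : ∀ z, newCand ℓ C z ∈ electedSet d k) (z : Fin ℓ) :
    score (c (k - ℓ)) ≤ S (newCand ℓ C z) := by
  have hf : Follows d c k := hd.follows hc fun _ _ _ y => hS y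
  obtain ⟨i, hi, hdi⟩ := mem_electedSet.1 (hmem z)
  -- Only `k - ℓ` old candidates are ever elected, so `c (k - ℓ)` is still available when `z` wins.
  have ho : oldCount d i ≤ k - ℓ := by
    rw [← oldCount_eq_of_forall_mem (fun i hi => (hd i hi).1) hmem]
    exact oldCount_mono d hi.le
  have h := (hd i hi).2 _ ((hf.mono hi.le).oldCand_notMem (fun i hi => (hc i hi).1)
    (by omega : k - ℓ < k) ho)
  simp only [hdi, hS] at h
  exact h.elim le_of_lt fun h => h.1.le

theorem IsGreedyRun.forall_newCand_mem {score : C → ℝ} {k : ℕ} {c : ℕ → C}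
    (hc : IsGreedyRun k (fun _ => score) c) {S : ExtCand ℓ C → ℝ} {d : ℕ → ExtCand ℓ C}
    (hd : IsGreedyRun k (fun _ => S) d) (hS : ∀ y, S (oldCand ℓ C y) = score y)
    (hℓk : ℓ ≤ k) (hnew : ∀ z, S (newCand ℓ C z) = score (c (k - ℓ))) (z : Fin ℓ) :
    newCand ℓ C z ∈ electedSet d k :=
  hd.newCand_mem (hd.follows hc fun _ _ _ y => hS y) hℓk le_rfl
    (fun _ _ _ => (hS _).le) (fun _ _ z _ => (hnew z).ge) z

theorem approvalWeight_nonneg (E : Election C V) (x : C) : 0 ≤ E.approvalWeight x :=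
  Finset.sum_nonneg fun v _ => E.weight_nonneg v

theorem savScore_nonneg (E : Election C V) (x : C) : 0 ≤ E.savScore x :=
  Finset.sum_nonneg fun v _ => div_nonneg (E.weight_nonneg v) (Nat.cast_nonneg _)

theorem approvalWeight_extend_oldCand (E : Election C V) (R : Replacement ℓ) (y : C) :
    (E.extend R).approvalWeight (oldCand ℓ C y) = E.approvalWeight y :=
  sum_supporters_extend_oldCand E R y _

theorem approvalWeight_extend_newCand_le (E : Election C V) (R : Replacement ℓ) (z : Fin ℓ) :
    (E.extend R).approvalWeight (newCand ℓ C z) ≤ R.totalWeight := by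
  refine (sum_supporters_extend_newCand E R z _).trans_le ?_
  exact Finset.sum_le_univ_sum_of_nonneg fun v => R.weight_nonneg v

theorem approvalWeight_oneVoter (E : Election C V) {x : ℝ} (hx : 0 ≤ x) (z : Fin ℓ) :
    (E.extend (Replacement.oneVoter ℓ x hx)).approvalWeight (newCand ℓ C z) = x :=
  sum_supporters_oneVoter E hx z _

theorem savScore_extend_oldCand (E : Election C V) (R : Replacement ℓ) (y : C) :
    (E.extend R).savScore (oldCand ℓ C y) = E.savScore y := by
  refine (sum_supporters_extend_oldCand E R y _).trans ?_
  simp [Election.extend, Election.savScore]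

theorem savScore_oneVoterEach (E : Election C V) {x : ℝ} (hx : 0 ≤ x) (z : Fin ℓ) :
    (E.extend (Replacement.oneVoterEach ℓ x hx)).savScore (newCand ℓ C z) = x := by
  refine (sum_supporters_oneVoterEach E hx z _).trans ?_
  simp [Election.extend, Replacement.oneVoterEach]

/-- Exchange the sums: a voter divides its weight equally among the candidates it approves, so it
contributes at most its weight in total. -/
theorem sum_savScore_newCand_le (E : Election C V) (R : Replacement ℓ) :
    ∑ z, (E.extend R).savScore (newCand ℓ C z) ≤ R.totalWeight := by
  have h : ∀ z, (E.extend R).savScore (newCand ℓ C z) =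
      ∑ v, if z ∈ R.approves v then R.weight v / ((R.approves v).card : ℝ) else 0 := by
    intro z
    rw [← Finset.sum_filter]
    refine (sum_supporters_extend_newCand E R z _).trans ?_
    simp [Election.extend]
  simp only [h]
  rw [Finset.sum_comm]
  refine Finset.sum_le_sum fun v _ => ?_
  rw [← Finset.sum_filter, Finset.filter_univ_mem, Finset.sum_const, nsmul_eq_mul, mul_div_left_comm]
  -- The bound `div_self_le_one` also covers an empty approval set, where the quotient is `0 / 0 =
  -- 0`.
  exact mul_le_of_le_one_right (R.weight_nonneg v) (div_self_le_one _)

theorem av_successful_oneVoter [Finite C] {E : Election C V} {c : ℕ → C} (hc : IsAVRun E c)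
    (hℓk : ℓ ≤ E.k) :
    (Replacement.oneVoter ℓ _ (approvalWeight_nonneg E (c (E.k - ℓ)))).Successful AV E := by
  obtain ⟨d, hd⟩ := exists_static_run (ℓ := ℓ) hc (E.extend (Replacement.oneVoter ℓ _
    (approvalWeight_nonneg E (c (E.k - ℓ))))).approvalWeight
  exact ⟨_, ⟨d, hd, rfl⟩, IsGreedyRun.forall_newCand_mem hc hd
    (approvalWeight_extend_oldCand E _) hℓk (approvalWeight_oneVoter E _)⟩

theorem isMinExogenousCost_av [Finite C] {E : Election C V} {c : ℕ → C} (hc : IsAVRun E c)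
    (hℓ : 1 ≤ ℓ) (hℓk : ℓ ≤ E.k) :
    IsMinExogenousCost AV E ℓ (E.approvalWeight (c (E.k - ℓ))) := by
  refine ⟨⟨_, av_successful_oneVoter hc hℓk, totalWeight_oneVoter _ _⟩, ?_⟩
  rintro _ ⟨R, ⟨_, ⟨d, hd, rfl⟩, hmem⟩, rfl⟩
  exact (IsGreedyRun.le_score_newCand hc hd (approvalWeight_extend_oldCand E R) hℓ hℓk hmem
    ⟨0, hℓ⟩).trans (approvalWeight_extend_newCand_le E R _)

theorem sav_successful_oneVoterEach [Finite C] {E : Election C V} {c : ℕ → C}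
    (hc : IsSAVRun E c) (hℓk : ℓ ≤ E.k) :
    (Replacement.oneVoterEach ℓ _ (savScore_nonneg E (c (E.k - ℓ)))).Successful SAV E := by
  obtain ⟨d, hd⟩ := exists_static_run (ℓ := ℓ) hc (E.extend (Replacement.oneVoterEach ℓ _
    (savScore_nonneg E (c (E.k - ℓ))))).savScore
  exact ⟨_, ⟨d, hd, rfl⟩, IsGreedyRun.forall_newCand_mem hc hd
    (savScore_extend_oldCand E _) hℓk (savScore_oneVoterEach E _)⟩

theorem isMinExogenousCost_sav [Finite C] {E : Election C V} {c : ℕ → C} (hc : IsSAVRun E c)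
    (hℓ : 1 ≤ ℓ) (hℓk : ℓ ≤ E.k) :
    IsMinExogenousCost SAV E ℓ (ℓ * E.savScore (c (E.k - ℓ))) := by
  refine ⟨⟨_, sav_successful_oneVoterEach hc hℓk, totalWeight_oneVoterEach _ _⟩, ?_⟩
  rintro _ ⟨R, ⟨_, ⟨d, hd, rfl⟩, hmem⟩, rfl⟩
  refine le_trans ?_ (sum_savScore_newCand_le E R)
  have := Finset.card_nsmul_le_sum Finset.univ _ _ fun z _ =>
    IsGreedyRun.le_score_newCand hc hd (savScore_extend_oldCand E R) hℓ hℓk hmem z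
  simpa using this

end StaticScores

/-! ### seq-Phragmén: election times and money spent -/

section SeqPhragmen

variable {C : Type u} {V : Type v} [LinearOrder C] {ℓ : ℕ}

theorem lastReset_congr (E : Election C V) {c c' : ℕ → C} {t t' : ℕ → ℝ} {i : ℕ}
    (hc : ∀ j < i, c j = c' j) (ht : ∀ j < i, t j = t' j) (v : V) :
    E.lastReset c t i v = E.lastReset c' t' i v := by
  induction i with
  | zero => rfl
  | succ i ih =>
    rw [Election.lastReset, Election.lastReset, hc i (by omega), ht i (by omega),
      ih (fun j hj => hc j (by omega)) (fun j hj => ht j (by omega))]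

theorem lastReset_nonneg (E : Election C V) {c : ℕ → C} {t : ℕ → ℝ} {i : ℕ}
    (ht : ∀ j < i, 0 ≤ t j) (v : V) : 0 ≤ E.lastReset c t i v := by
  induction i with
  | zero => exact le_rfl
  | succ i ih =>
    rw [Election.lastReset]
    split_ifs
    · exact ht i (by omega)
    · exact ih fun j hj => ht j (by omega)

theorem lastReset_le (E : Election C V) {c : ℕ → C} {t : ℕ → ℝ} {i : ℕ} {s : ℝ} (hs : 0 ≤ s)
    (ht : ∀ j < i, t j ≤ s) (v : V) : E.lastReset c t i v ≤ s := by
  induction i with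
  | zero => exact hs
  | succ i ih =>
    rw [Election.lastReset]
    split_ifs
    · exact ht i (by omega)
    · exact ih fun j hj => ht j (by omega)

theorem lastReset_eq_zero (E : Election C V) {c : ℕ → C} {t : ℕ → ℝ} {i : ℕ} {v : V}
    (h : ∀ j < i, c j ∉ E.approves v) : E.lastReset c t i v = 0 := by
  induction i with
  | zero => rfl
  | succ i ih =>
    rw [Election.lastReset, if_neg (h i (by omega)), ih fun j hj => h j (by omega)]

/-- Electing a new candidate resets no old voter, so the history of an old voter depends only on the
subsequence of old winners and their times. -/
theorem lastReset_extend_inr {E : Election C V} {R : Replacement ℓ} {k : ℕ} {c : ℕ → C}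
    {t : ℕ → ℝ} {d : ℕ → ExtCand ℓ C} {T : ℕ → ℝ} (hf : Follows d c k)
    (hT : ∀ i < k, ∀ y, d i = oldCand ℓ C y → T i = t (oldCount d i)) (v : V) :
    (E.extend R).lastReset d T k (Sum.inr v) = E.lastReset c t (oldCount d k) v := by
  induction k with
  | zero => rfl
  | succ n ih =>
    have ih := ih (hf.mono n.le_succ) fun i hi => hT i (by omega)
    rcases eq_newCand_or_eq_oldCand (d n) with ⟨z, hz⟩ | ⟨y, hy⟩
    · rw [oldCount_succ_of_new hz, Election.lastReset, hz,
        if_neg (newCand_notMem_approves_inr E R z v), ih]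
    · rw [oldCount_succ_of_old hy, Election.lastReset, Election.lastReset, ih,
        ← hf n (by omega) y hy, hT n (by omega) y hy, hy]
      simp only [oldCand_mem_approves_inr]

variable [Fintype V]

theorem supporterMoney_congr (E : Election C V) {c c' : ℕ → C} {t t' : ℕ → ℝ} {i : ℕ}
    (hc : ∀ j < i, c j = c' j) (ht : ∀ j < i, t j = t' j) (s : ℝ) (x : C) :
    E.supporterMoney c t i s x = E.supporterMoney c' t' i s x :=
  Finset.sum_congr rfl fun v _ => by rw [lastReset_congr E hc ht]

theorem supporterMoney_eq (E : Election C V) (c : ℕ → C) (t : ℕ → ℝ) (i : ℕ) (s : ℝ) (x : C) :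
    E.supporterMoney c t i s x = E.approvalWeight x * s -
      ∑ v ∈ E.supporters x, E.weight v * E.lastReset c t i v := by
  simp only [Election.supporterMoney, Election.approvalWeight, mul_sub, Finset.sum_sub_distrib,
    Finset.sum_mul]

/-- The first `n` rounds of seq-Phragmén. -/
def IsPartialPhragmenRun (E : Election C V) (n : ℕ) (c : ℕ → C) (t : ℕ → ℝ) : Prop :=
  ∀ i < n,
    IsLeast {s : ℝ | 0 ≤ s ∧ (∀ j < i, t j ≤ s) ∧
      ∃ x, x ∉ electedSet c i ∧ 1 ≤ E.supporterMoney c t i s x} (t i) ∧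
    IsLeast {x : C | x ∉ electedSet c i ∧ 1 ≤ E.supporterMoney c t i (t i) x} (c i)

/-- The money behind `x` grows linearly with positive slope, so some time is feasible. Finiteness of
`C` makes the feasible set closed, so its infimum is attained. -/
theorem exists_phragmen_round [Finite C] (E : Election C V) {c : ℕ → C} {t : ℕ → ℝ} {n : ℕ}
    {x : C} (hx : x ∉ electedSet c n) (hwx : 0 < E.approvalWeight x) :
    ∃ s y, IsLeast {s : ℝ | 0 ≤ s ∧ (∀ j < n, t j ≤ s) ∧
        ∃ x, x ∉ electedSet c n ∧ 1 ≤ E.supporterMoney c t n s x} s ∧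
      IsLeast {x : C | x ∉ electedSet c n ∧ 1 ≤ E.supporterMoney c t n s x} y := by
  set S := {s : ℝ | 0 ≤ s ∧ (∀ j < n, t j ≤ s) ∧
        ∃ x, x ∉ electedSet c n ∧ 1 ≤ E.supporterMoney c t n s x} with hS
  have hclosed : IsClosed S := by
    have : S = Set.Ici 0 ∩ ((⋂ j, ⋂ (_ : j < n), Set.Ici (t j)) ∩
        ⋃ x ∈ {x | x ∉ electedSet c n}, {s | 1 ≤ E.supporterMoney c t n s x}) := by
      ext s
      simp [hS]
    rw [this]
    refine isClosed_Ici.inter (IsClosed.inter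
      (isClosed_iInter fun j => isClosed_iInter fun _ => isClosed_Ici) ?_)
    refine (Set.toFinite _).isClosed_biUnion fun x _ => isClosed_le continuous_const ?_
    unfold Election.supporterMoney
    fun_prop
  have hne : S.Nonempty := by
    set B := ∑ j ∈ Finset.range n, |t j| with hB
    set D := ∑ v ∈ E.supporters x, E.weight v * E.lastReset c t n v with hD
    -- `B` exceeds all earlier times; at time `(1 + D) / E.approvalWeight x` the supporters of `x`
    -- own exactly one unit.
    refine ⟨max B ((1 + D) / E.approvalWeight x), le_max_of_le_left ?_, fun j hj => ?_, x, hx, ?_⟩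
    · exact Finset.sum_nonneg fun j _ => abs_nonneg _
    · refine le_max_of_le_left ((le_abs_self _).trans ?_)
      exact Finset.single_le_sum (f := fun j => |t j|) (fun j _ => abs_nonneg _)
        (Finset.mem_range.2 hj)
    · rw [supporterMoney_eq, ← hD]
      have := mul_le_mul_of_nonneg_left (le_max_right B ((1 + D) / E.approvalWeight x)) hwx.le
      rw [mul_div_cancel₀ _ hwx.ne'] at this
      linarith
  have hleast : IsLeast S (sInf S) := hclosed.isLeast_csInf hne ⟨0, fun s hs => hs.1⟩
  obtain ⟨y, hy⟩ := hleast.1.2.2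
  obtain ⟨m, hm, hmin⟩ := Set.exists_min_image
    {x : C | x ∉ electedSet c n ∧ 1 ≤ E.supporterMoney c t n (sInf S) x} id (Set.toFinite _) ⟨y, hy⟩
  exact ⟨sInf S, m, hleast, hm, hmin⟩

/-- `P` is a reserve of candidates with positive support: before each of the `n` rounds fewer than
`P.card` candidates are elected, so one of them remains and the round ends in finite time. -/
theorem exists_isPartialPhragmenRun [Finite C] (E : Election C V) (P : Finset C)
    (hP : ∀ x ∈ P, 0 < E.approvalWeight x) {n : ℕ} (hn : n ≤ P.card) [Nonempty C] :
    ∃ c t, IsPartialPhragmenRun E n c t := by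
  induction n with
  | zero => exact ⟨fun _ => Classical.arbitrary C, fun _ => 0, fun i hi => absurd hi i.not_lt_zero⟩
  | succ n ih =>
    obtain ⟨c, t, h⟩ := ih (by omega)
    obtain ⟨x, hxP, hx⟩ := Finset.exists_mem_notMem_of_card_lt_card
      ((card_electedSet_le c n).trans_lt hn)
    obtain ⟨s, y, hs, hy⟩ := exists_phragmen_round E (t := t) hx (hP x hxP)
    refine ⟨Function.update c n y, Function.update t n s, fun i hi => ?_⟩
    have hc' : ∀ j < i, Function.update c n y j = c j :=
      fun j hj => Function.update_of_ne (by omega) _ _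
    have ht' : ∀ j < i, Function.update t n s j = t j :=
      fun j hj => Function.update_of_ne (by omega) _ _
    have ht'' : ∀ r, (∀ j < i, Function.update t n s j ≤ r) ↔ ∀ j < i, t j ≤ r :=
      fun r => forall₂_congr fun j hj => by rw [ht' j hj]
    simp only [electedSet_congr hc', supporterMoney_congr E hc' ht', ht'']
    rcases Nat.lt_succ_iff_lt_or_eq.1 hi with hi | rfl
    · rw [Function.update_of_ne hi.ne, Function.update_of_ne hi.ne]
      exact h i hi
    · rw [Function.update_self, Function.update_self]
      exact ⟨hs, hy⟩

namespace IsPartialPhragmenRun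

variable {E : Election C V} {k : ℕ} {c : ℕ → C} {t : ℕ → ℝ}

theorem notMem (h : IsPartialPhragmenRun E k c t) : ∀ i < k, c i ∉ electedSet c i :=
  fun i hi => (h i hi).2.1.1

theorem time_mono (h : IsPartialPhragmenRun E k c t) {i j : ℕ} (hij : i ≤ j) (hj : j < k) :
    t i ≤ t j := by
  rcases hij.eq_or_lt with rfl | hij
  · exact le_rfl
  · exact (h j hj).1.1.2.1 i hij

theorem time_pos (h : IsPartialPhragmenRun E k c t) {i : ℕ} (hi : i < k) : 0 < t i := by
  refine lt_of_lt_of_le ?_ (h.time_mono (Nat.zero_le i) hi)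
  have h0 := h 0 (by omega)
  refine lt_of_le_of_ne h0.1.1.1 fun h' => ?_
  have := h0.2.1.2
  rw [← h'] at this
  norm_num [Election.supporterMoney, Election.lastReset] at this

/-- Supporters of total weight zero never own a unit of money. Hence the original winners can serve
as the reserve that keeps the extended election running. -/
theorem approvalWeight_pos (h : IsPartialPhragmenRun E k c t) {i : ℕ} (hi : i < k) :
    0 < E.approvalWeight (c i) := by
  refine lt_of_le_of_ne (approvalWeight_nonneg E _) fun h' => ?_
  have := (h i hi).2.1.2
  rw [supporterMoney_eq, ← h', zero_mul] at this
  have h2 : 0 ≤ ∑ v ∈ E.supporters (c i), E.weight v * E.lastReset c t i v :=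
    Finset.sum_nonneg fun v _ => mul_nonneg (E.weight_nonneg v)
      (lastReset_nonneg E (fun j hj => (h.time_pos (hj.trans hi)).le) v)
  linarith

variable {R : Replacement ℓ} {d : ℕ → ExtCand ℓ C} {T : ℕ → ℝ}

theorem supporterMoney_extend_oldCand (hf : Follows d c k)
    (hT : ∀ i < k, ∀ y, d i = oldCand ℓ C y → T i = t (oldCount d i)) (s : ℝ) (y : C) :
    (E.extend R).supporterMoney d T k s (oldCand ℓ C y) =
      E.supporterMoney c t (oldCount d k) s y := by
  refine (sum_supporters_extend_oldCand E R y _).trans ?_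
  refine Finset.sum_congr rfl fun v _ => ?_
  rw [lastReset_extend_inr hf hT]
  rfl

/-- In the extended election, the old candidates are elected in the same order and at the same
times, and every new candidate is elected no later than the next old one. -/
theorem follows (hc : IsPartialPhragmenRun E k c t) (hd : IsPartialPhragmenRun (E.extend R) k d T) :
    Follows d c k ∧ (∀ i < k, ∀ y, d i = oldCand ℓ C y → T i = t (oldCount d i)) ∧
      ∀ i < k, T i ≤ t (oldCount d i) := by
  suffices ∀ n ≤ k, Follows d c n ∧ (∀ i < n, ∀ y, d i = oldCand ℓ C y → T i = t (oldCount d i)) ∧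
      ∀ i < n, T i ≤ t (oldCount d i) from this k le_rfl
  intro n
  induction n with
  | zero => exact fun _ => ⟨fun i hi => absurd hi i.not_lt_zero,
      fun i hi => absurd hi i.not_lt_zero, fun i hi => absurd hi i.not_lt_zero⟩
  | succ n ih =>
    intro hn
    obtain ⟨hf, hT, hle⟩ := ih (by omega)
    have hon : oldCount d n < k := (oldCount_le d n).trans_lt hn
    obtain ⟨⟨-, htleast⟩, ⟨hcn, hcm⟩, hcleast⟩ := hc _ hon
    obtain ⟨⟨⟨hT0, hTj, -⟩, hTleast⟩, ⟨hdn, hdm⟩, hdleast⟩ := hd n hn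
    have hcd : oldCand ℓ C (c (oldCount d n)) ∉ electedSet d n := by rwa [hf.mem_iff]
    -- The next old candidate can be afforded at its original time, so the round ends no later.
    have hTn : T n ≤ t (oldCount d n) := by
      refine hTleast ⟨(hc.time_pos hon).le, fun j hj => ?_, _, hcd, ?_⟩
      · exact (hle j hj).trans (hc.time_mono (oldCount_mono d hj.le) hon)
      · rwa [supporterMoney_extend_oldCand hf hT]
    have key : ∀ y, d n = oldCand ℓ C y → y = c (oldCount d n) ∧ T n = t (oldCount d n) := by
      intro y hy
      rw [hy, hf.mem_iff] at hdn
      rw [hy, supporterMoney_extend_oldCand hf hT] at hdm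
      have hTeq : T n = t (oldCount d n) := by
        -- Conversely, an old winner at time `T n` makes `T n` feasible in the original round, whose
        -- time is least.
        refine le_antisymm hTn (htleast ⟨hT0, fun j hj => ?_, y, hdn, hdm⟩)
        obtain ⟨i, hi, rfl, hdi⟩ := hf.exists_eq hj
        rw [← hT i hi _ hdi]
        exact hTj i hi
      refine ⟨le_antisymm ?_ (hcleast ⟨hdn, hTeq ▸ hdm⟩), hTeq⟩
      rw [← oldCand_le_oldCand (ℓ := ℓ), ← hy]
      refine hdleast ⟨hcd, ?_⟩
      rwa [supporterMoney_extend_oldCand hf hT, hTeq]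
    refine ⟨fun i hi => ?_, fun i hi => ?_, fun i hi => ?_⟩ <;>
      rcases Nat.lt_succ_iff_lt_or_eq.1 hi with hi | rfl
    · exact hf i hi
    · exact fun y hy => (key y hy).1
    · exact hT i hi
    · exact fun y hy => (key y hy).2
    · exact hle i hi
    · exact hTn

/-- The elected new candidates have been paid for by the new voters. -/
theorem card_newCand_le (hd : IsPartialPhragmenRun (E.extend R) k d T) :
    ((Finset.univ.filter fun z => newCand ℓ C z ∈ electedSet d k).card : ℝ) ≤
      ∑ v, R.weight v * (E.extend R).lastReset d T k (Sum.inl v) := by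
  induction k with
  | zero => simp [electedSet_zero, Election.lastReset]
  | succ n ih =>
    have hdn : IsPartialPhragmenRun (E.extend R) n d T := fun i hi => hd i (by omega)
    have ih := ih hdn
    have hcard := oldCount_add_card hd.notMem
    have hcard' := oldCount_add_card hdn.notMem
    rcases eq_newCand_or_eq_oldCand (d n) with ⟨z, hz⟩ | ⟨y, hy⟩
    · rw [oldCount_succ_of_new hz] at hcard
      have hc : (Finset.univ.filter fun z => newCand ℓ C z ∈ electedSet d (n + 1)).card =
          (Finset.univ.filter fun z => newCand ℓ C z ∈ electedSet d n).card + 1 := by omega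
      have hm := (hd n (by omega)).2.1.2
      rw [hz] at hm
      have hm' : (E.extend R).supporterMoney d T n (T n) (newCand ℓ C z) =
          ∑ v with z ∈ R.approves v,
            R.weight v * (T n - (E.extend R).lastReset d T n (Sum.inl v)) :=
        sum_supporters_extend_newCand E R z _
      rw [hm', Finset.sum_filter] at hm
      rw [hc]
      push_cast
      -- The weight of a voter times its last reset is all the money it has spent. Moving the
      -- supporters' resets to `T n` adds exactly the money they own then, which is at least `1`.
      refine (add_le_add ih hm).trans_eq ?_
      rw [← Finset.sum_add_distrib]
      refine Finset.sum_congr rfl fun v _ => ?_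
      rw [Election.lastReset, hz]
      simp only [newCand_mem_approves_inl]
      split_ifs <;> ring
    · rw [oldCount_succ_of_old hy] at hcard
      have hc : (Finset.univ.filter fun z => newCand ℓ C z ∈ electedSet d (n + 1)).card =
          (Finset.univ.filter fun z => newCand ℓ C z ∈ electedSet d n).card := by omega
      rw [hc]
      refine ih.trans_eq (Finset.sum_congr rfl fun v _ => ?_)
      rw [Election.lastReset, hy, if_neg (oldCand_notMem_approves_inl E R y v)]

/-- The new voters have spent at least `ℓ` units by their last resets, and no reset is later than `t
(k - ℓ)`, so their earnings up to that time must suffice. -/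
theorem le_totalWeight_mul_time (hc : IsPartialPhragmenRun E k c t)
    (hd : IsPartialPhragmenRun (E.extend R) k d T) (hℓ : 1 ≤ ℓ) (hℓk : ℓ ≤ k)
    (hmem : ∀ z, newCand ℓ C z ∈ electedSet d k) : (ℓ : ℝ) ≤ R.totalWeight * t (k - ℓ) := by
  obtain ⟨-, -, hle⟩ := hc.follows hd
  have h := hd.card_newCand_le
  simp only [hmem, Finset.filter_true, Finset.card_univ, Fintype.card_fin] at h
  refine h.trans ?_
  rw [Replacement.totalWeight, Finset.sum_mul]
  refine Finset.sum_le_sum fun v _ => mul_le_mul_of_nonneg_left ?_ (R.weight_nonneg v)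
  refine lastReset_le _ (hc.time_pos (by omega)).le (fun j hj => (hle j hj).trans ?_) _
  refine hc.time_mono ?_ (by omega)
  rw [← oldCount_eq_of_forall_mem hd.notMem hmem]
  exact oldCount_mono d hj.le

theorem forall_newCand_mem (hc : IsPartialPhragmenRun E k c t) (hℓk : ℓ ≤ k) {x : ℝ} (hx : 0 ≤ x)
    (hxt : x * t (k - ℓ) = 1)
    (hd : IsPartialPhragmenRun (E.extend (Replacement.oneVoterEach ℓ x hx)) k d T) (z : Fin ℓ) :
    newCand ℓ C z ∈ electedSet d k := by
  by_contra hz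
  obtain ⟨hf, hT, -⟩ := hc.follows hd
  obtain ⟨i, hi, ho, hdi⟩ := hf.exists_eq (lt_oldCount_of_notMem hℓk hd.notMem hz)
  have hTi := hT i hi _ hdi
  have hz' : newCand ℓ C z ∉ electedSet d i := fun h => hz (electedSet_mono d hi.le h)
  -- The only supporter of `z` approves nobody else, so it has saved since time `0` and owns exactly
  -- one unit at time `t (k - ℓ)`.
  have h0 : (E.extend (Replacement.oneVoterEach ℓ x hx)).lastReset d T i (Sum.inl z) = 0 := by
    refine lastReset_eq_zero _ fun j hj h => ?_
    rcases eq_newCand_or_eq_oldCand (d j) with ⟨z', h'⟩ | ⟨y, h'⟩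
    · rw [h'] at h
      obtain rfl : z' = z := Finset.mem_singleton.1 ((newCand_mem_approves_inl E _ z' _).1 h)
      exact hz' (mem_electedSet.2 ⟨j, hj, h'⟩)
    · rw [h'] at h
      exact oldCand_notMem_approves_inl E _ y _ h
  have hmoney : (E.extend (Replacement.oneVoterEach ℓ x hx)).supporterMoney d T i (T i)
      (newCand ℓ C z) = 1 := by
    refine (sum_supporters_oneVoterEach E hx z _).trans ?_
    rw [h0, hTi, ho, sub_zero]
    exact hxt
  have := (hd i hi).2.2 ⟨hz', hmoney.ge⟩
  rw [hdi] at this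
  exact absurd this (newCand_lt_oldCand z _).not_ge

theorem exists_extend [Finite C] (hc : IsPartialPhragmenRun E k c t) (R : Replacement ℓ) :
    ∃ d T, IsPartialPhragmenRun (E.extend R) k d T := by
  have : Nonempty (ExtCand ℓ C) := ⟨oldCand ℓ C (c 0)⟩
  refine exists_isPartialPhragmenRun (E.extend R) ((electedSet c k).map (oldCand ℓ C)) ?_ ?_
  · intro x hx
    obtain ⟨y, hy, rfl⟩ := Finset.mem_map.1 hx
    obtain ⟨i, hi, rfl⟩ := mem_electedSet.1 hy
    rw [approvalWeight_extend_oldCand]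
    exact hc.approvalWeight_pos hi
  · rw [Finset.card_map, card_electedSet hc.notMem]

end IsPartialPhragmenRun

theorem seqPhragmen_successful_oneVoterEach [Finite C] {E : Election C V} {c : ℕ → C} {t : ℕ → ℝ}
    (hc : IsSeqPhragmenRun E c t) (hℓk : ℓ ≤ E.k) {x : ℝ} (hx : 0 ≤ x)
    (hxt : x * t (E.k - ℓ) = 1) :
    (Replacement.oneVoterEach ℓ x hx).Successful SeqPhragmen E := by
  have hc : IsPartialPhragmenRun E E.k c t := hc
  obtain ⟨d, T, hd⟩ := hc.exists_extend (Replacement.oneVoterEach ℓ x hx)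
  exact ⟨_, ⟨d, T, hd, rfl⟩, hc.forall_newCand_mem hℓk hx hxt hd⟩

theorem seqPhragmen_time_pos {E : Election C V} {c : ℕ → C} {t : ℕ → ℝ}
    (hc : IsSeqPhragmenRun E c t) {i : ℕ} (hi : i < E.k) : 0 < t i :=
  IsPartialPhragmenRun.time_pos hc hi

theorem isMinExogenousCost_seqPhragmen [Finite C] {E : Election C V} {c : ℕ → C} {t : ℕ → ℝ}
    (hc : IsSeqPhragmenRun E c t) (hℓ : 1 ≤ ℓ) (hℓk : ℓ ≤ E.k) :
    IsMinExogenousCost SeqPhragmen E ℓ (ℓ / t (E.k - ℓ)) := by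
  have hpos : 0 < t (E.k - ℓ) := seqPhragmen_time_pos hc (by omega)
  refine ⟨⟨_, seqPhragmen_successful_oneVoterEach hc hℓk (one_div_pos.2 hpos).le
    (one_div_mul_cancel hpos.ne'), ?_⟩, ?_⟩
  · rw [totalWeight_oneVoterEach, mul_one_div]
  · rintro _ ⟨R, ⟨_, ⟨d, T, hd, rfl⟩, hmem⟩, rfl⟩
    rw [div_le_iff₀ hpos]
    exact IsPartialPhragmenRun.le_totalWeight_mul_time hc hd hℓ hℓk hmem

end SeqPhragmen

/-! ### Balanced vote assignments: local conditions, uniqueness of backings, existence -/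

section Balanced

variable {C : Type u} {V : Type v} {E : Election C V} {W : Finset C} {α β γ : V → C → ℝ}

theorem Election.IsVoteAssignment.eq_zero (hα : E.IsVoteAssignment W α) {v : V} {c : C}
    (h : ¬(c ∈ W ∧ c ∈ E.approves v)) : α v c = 0 :=
  le_antisymm (not_lt.1 fun h' => h (hα.supported v c h')) (hα.nonneg v c)

variable [LinearOrder C] [Fintype V]

theorem Election.IsVoteAssignment.backing_nonneg (hα : E.IsVoteAssignment W α) (c : C) :
    0 ≤ E.backing α c :=
  Finset.sum_nonneg fun v _ => hα.nonneg v c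

theorem Election.IsVoteAssignment.backing_eq (hα : E.IsVoteAssignment W α) (c : C) :
    E.backing α c = ∑ v, α v c :=
  Finset.sum_subset (Finset.subset_univ _) fun _ _ hv =>
    hα.eq_zero fun h => hv (mem_supporters.2 h.2)

/-- Double counting reduces comparisons of backing weights to comparisons for a single voter. -/
theorem Election.IsVoteAssignment.sum_mul_backing (hα : E.IsVoteAssignment W α) (S : Finset C)
    (g : C → ℝ) : ∑ c ∈ S, g c * E.backing α c = ∑ v, ∑ c ∈ S, α v c * g c := by
  rw [Finset.sum_comm]
  refine Finset.sum_congr rfl fun c _ => ?_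
  rw [hα.backing_eq, mul_comm, Finset.sum_mul]

theorem Election.IsVoteAssignment.exists_perturbation (hα : E.IsVoteAssignment W α) (v : V)
    (δ : C → ℝ) (hδ : ∀ c, δ c ≠ 0 → c ∈ W ∧ c ∈ E.approves v) (h0 : ∀ c, 0 ≤ α v c + δ c)
    (hw : ∑ c ∈ W, (α v c + δ c) ≤ E.weight v) :
    ∃ β, E.IsVoteAssignment W β ∧ ∀ c, E.backing β c = E.backing α c + δ c := by
  classical
  have hβ : E.IsVoteAssignment W fun v' c => α v' c + if v' = v then δ c else 0 := by
    refine ⟨fun v' c => ?_, fun v' c h => ?_, fun v' => ?_⟩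
    · by_cases hv : v' = v
      · simpa [hv] using h0 c
      · simpa [hv] using hα.nonneg v' c
    · by_cases hv : v' = v
      · subst hv
        by_cases hc : δ c = 0
        · exact hα.supported v' c (by simpa [hc] using h)
        · exact hδ c hc
      · exact hα.supported v' c (by simpa [hv] using h)
    · by_cases hv : v' = v
      · simpa [hv] using hw
      · simpa [hv] using hα.le_weight v'
  refine ⟨_, hβ, fun c => ?_⟩
  rw [hβ.backing_eq, hα.backing_eq, Finset.sum_add_distrib]
  simp

/-- Every voter who approves a committee member spends the whole weight, and only on supported
committee members of minimum backing weight. -/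
structure Election.IsLocallyBalanced (E : Election C V) (W : Finset C) (α : V → C → ℝ) :
    Prop where
  isVoteAssignment : E.IsVoteAssignment W α
  sum_eq_weight : ∀ v, ∀ d ∈ W, d ∈ E.approves v → ∑ c ∈ W, α v c = E.weight v
  backing_le : ∀ v c, 0 < α v c → ∀ d ∈ W, d ∈ E.approves v → E.backing α c ≤ E.backing α d

/-- These are first-order conditions: unspent weight given to an approved member would raise the sum
of backings, and a small shift to a less backed member would lower the sum of squares. -/
theorem Election.IsBalanced.isLocallyBalanced (h : E.IsBalanced W α) :
    E.IsLocallyBalanced W α := by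
  have hα := h.isVoteAssignment
  refine ⟨hα, fun v d hd hdv => ?_, fun v c hc d hd hdv => ?_⟩
  · refine le_antisymm (hα.le_weight v) (not_lt.1 fun hlt => ?_)
    set ε := E.weight v - ∑ c ∈ W, α v c with hε
    have hε0 : 0 < ε := sub_pos.2 hlt
    obtain ⟨β, hβ, hb⟩ := hα.exists_perturbation v (fun c => if c = d then ε else 0)
      (fun c hc => by
        obtain rfl : c = d := by by_contra h; simp [h] at hc
        exact ⟨hd, hdv⟩)
      (fun c => add_nonneg (hα.nonneg v c) (by split_ifs <;> linarith))
      (by rw [Finset.sum_add_distrib, Finset.sum_ite_eq', if_pos hd]; linarith)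
    have := h.max_sum β hβ
    simp only [hb, Finset.sum_add_distrib, Finset.sum_ite_eq', if_pos hd] at this
    linarith
  · by_contra! hlt
    have hne : c ≠ d := fun h => by rw [h] at hlt; exact lt_irrefl _ hlt
    obtain ⟨hcW, hcv⟩ := hα.supported v c hc
    -- Shifting `ε` changes the sum of squares by `2 * ε * (ε - gap)`, which is negative for `ε`
    -- below the gap between the two backings.
    obtain ⟨ε, hε0, hε⟩ : ∃ ε, 0 < ε ∧ ε ≤ α v c ∧ ε < E.backing α c - E.backing α d :=
      ⟨min (α v c) ((E.backing α c - E.backing α d) / 2), lt_min hc (by linarith), min_le_left _ _,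
        (min_le_right _ _).trans_lt (by linarith)⟩
    obtain ⟨hεc, hεd⟩ := hε
    let δ : C → ℝ := fun x => (if x = d then ε else 0) - if x = c then ε else 0
    have hsum : ∑ x ∈ W, δ x = 0 := by
      simp only [δ, Finset.sum_sub_distrib, Finset.sum_ite_eq', if_pos hd, if_pos hcW, sub_self]
    obtain ⟨β, hβ, hb⟩ := hα.exists_perturbation v δ
      (fun x hx => by
        by_cases hxd : x = d
        · exact hxd ▸ ⟨hd, hdv⟩
        by_cases hxc : x = c
        · exact hxc ▸ ⟨hcW, hcv⟩
        simp [δ, hxd, hxc] at hx)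
      (fun x => by
        by_cases hxc : x = c
        · simp only [δ, hxc, if_neg hne, if_true]; linarith
        · have := hα.nonneg v x
          simp only [δ, if_neg hxc]
          split_ifs <;> linarith)
      (by rw [Finset.sum_add_distrib, hsum, add_zero]; exact hα.le_weight v)
    have h1 := h.min_sq β hβ (by simp only [hb, Finset.sum_add_distrib, hsum, add_zero])
    have h2 : ∀ x, E.backing β x ^ 2 = E.backing α x ^ 2 +
        ((if x = d then 2 * ε * E.backing α x + ε ^ 2 else 0) +
          if x = c then ε ^ 2 - 2 * ε * E.backing α x else 0) := by
      intro x
      rw [hb]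
      by_cases hxc : x = c
      · have hxd : x ≠ d := hxc ▸ hne
        simp only [δ, if_pos hxc, if_neg hxd]; ring
      · simp only [δ, if_neg hxc]
        split_ifs <;> ring
    simp only [h2, Finset.sum_add_distrib, Finset.sum_ite_eq', if_pos hd, if_pos hcW] at h1
    nlinarith

namespace Election.IsLocallyBalanced

theorem sum_mul_eq (hα : E.IsLocallyBalanced W α) {v : V} {d : C} (hd : d ∈ W)
    (hdv : d ∈ E.approves v)
    (hmin : ∀ c ∈ W, c ∈ E.approves v → E.backing α d ≤ E.backing α c) (f : ℝ → ℝ) :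
    ∑ c ∈ W, α v c * f (E.backing α c) = E.weight v * f (E.backing α d) := by
  rw [← hα.sum_eq_weight v d hd hdv, Finset.sum_mul]
  refine Finset.sum_congr rfl fun c _ => ?_
  rcases (hα.isVoteAssignment.nonneg v c).eq_or_lt with h | h
  · rw [← h, zero_mul, zero_mul]
  · obtain ⟨hc, hcv⟩ := hα.isVoteAssignment.supported v c h
    rw [le_antisymm (hα.backing_le v c h d hd hdv) (hmin c hc hcv)]

theorem exists_min_or (E : Election C V) (W : Finset C) (α : V → C → ℝ) (v : V) :
    (∀ c, ¬(c ∈ W ∧ c ∈ E.approves v)) ∨ ∃ d ∈ W, d ∈ E.approves v ∧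
      ∀ c ∈ W, c ∈ E.approves v → E.backing α d ≤ E.backing α c := by
  rcases (W ∩ E.approves v).eq_empty_or_nonempty with h | h
  · exact Or.inl fun c hc => Finset.notMem_empty c (h ▸ Finset.mem_inter.2 hc)
  · obtain ⟨d, hd, hmin⟩ := Finset.exists_min_image _ (E.backing α) h
    rw [Finset.mem_inter] at hd
    exact Or.inr ⟨d, hd.1, hd.2, fun c hc hcv => hmin c (Finset.mem_inter.2 ⟨hc, hcv⟩)⟩

/-- Price each member at its backing under `α`. Every voter spends its weight under `α` on its
cheapest approved members, so `β` cannot cost less. -/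
theorem sum_sq_le (hα : E.IsLocallyBalanced W α) (hβ : E.IsLocallyBalanced W β) :
    ∑ c ∈ W, E.backing α c * E.backing α c ≤ ∑ c ∈ W, E.backing α c * E.backing β c := by
  rw [hα.isVoteAssignment.sum_mul_backing, hβ.isVoteAssignment.sum_mul_backing]
  refine Finset.sum_le_sum fun v _ => ?_
  rcases exists_min_or E W α v with h | ⟨d, hd, hdv, hmin⟩
  · simp [hα.isVoteAssignment.eq_zero (h _), hβ.isVoteAssignment.eq_zero (h _)]
  · rw [hα.sum_mul_eq hd hdv hmin fun b => b, ← hβ.sum_eq_weight v d hd hdv, Finset.sum_mul]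
    refine Finset.sum_le_sum fun c hc => ?_
    by_cases hcv : c ∈ E.approves v
    · exact mul_le_mul_of_nonneg_left (hmin c hc hcv) (hβ.isVoteAssignment.nonneg v c)
    · simp [hβ.isVoteAssignment.eq_zero fun h => hcv h.2]

/-- Adding `sum_sq_le` in both directions shows that the squared distance between the two backing
vectors is at most zero. -/
theorem backing_eq_backing (hα : E.IsLocallyBalanced W α) (hβ : E.IsLocallyBalanced W β) {c : C}
    (hc : c ∈ W) : E.backing α c = E.backing β c := by
  have h1 := hα.sum_sq_le hβ
  have h2 := hβ.sum_sq_le hα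
  have h3 : ∑ c ∈ W, (E.backing α c - E.backing β c) ^ 2 =
      (∑ c ∈ W, E.backing α c * E.backing α c - ∑ c ∈ W, E.backing α c * E.backing β c) +
      (∑ c ∈ W, E.backing β c * E.backing β c - ∑ c ∈ W, E.backing β c * E.backing α c) := by
    rw [← Finset.sum_sub_distrib, ← Finset.sum_sub_distrib, ← Finset.sum_add_distrib]
    exact Finset.sum_congr rfl fun c _ => by ring
  have h4 : ∑ c ∈ W, (E.backing α c - E.backing β c) ^ 2 = 0 :=
    le_antisymm (by linarith) (Finset.sum_nonneg fun c _ => sq_nonneg _)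
  exact sub_eq_zero.1 (pow_eq_zero_iff two_ne_zero |>.1
    ((Finset.sum_eq_zero_iff_of_nonneg fun c _ => sq_nonneg _).1 h4 c hc))

/-- All spending of a voter goes to members of one common backing weight, the minimum among those it
approves. So the slack depends on the backings alone, not on how the weight is divided. -/
theorem slack_eq_slack (hα : E.IsLocallyBalanced W α) (hβ : E.IsLocallyBalanced W β) (v : V)
    (t : ℝ) : E.slack W α v t = E.slack W β v t := by
  rcases exists_min_or E W α v with h | ⟨d, hd, hdv, hmin⟩
  · simp [Election.slack, hα.isVoteAssignment.eq_zero (h _), hβ.isVoteAssignment.eq_zero (h _)]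
  · have hmin' : ∀ c ∈ W, c ∈ E.approves v → E.backing β d ≤ E.backing β c := fun c hc hcv => by
      rw [← hα.backing_eq_backing hβ hd, ← hα.backing_eq_backing hβ hc]
      exact hmin c hc hcv
    rw [Election.slack, Election.slack, hα.sum_mul_eq hd hdv hmin fun b => min 1 (t / b),
      hβ.sum_mul_eq hd hdv hmin' fun b => min 1 (t / b), hα.backing_eq_backing hβ hd]

theorem phragmmsScore_eq (hα : E.IsLocallyBalanced W α) (hβ : E.IsLocallyBalanced W β) (x : C) :
    E.phragmmsScore W α x = E.phragmmsScore W β x := by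
  simp only [Election.phragmmsScore, Election.prescore, hα.slack_eq_slack hβ]

/-- A balanced vote assignment maximises the minimum backing weight. -/
theorem le_backing (hα : E.IsLocallyBalanced W α) (hγ : E.IsVoteAssignment W γ) {m : ℝ}
    (hm : ∀ c ∈ W, m ≤ E.backing γ c) : ∀ c ∈ W, m ≤ E.backing α c := by
  by_contra! hex
  obtain ⟨c, hc, hlt⟩ := hex
  -- A voter approving some member of `X` spends everything inside `X` under `α`, so no assignment
  -- gives `X` more total backing; but `γ` would.
  set X := W.filter fun c => E.backing α c < m with hX
  have hXW : X ⊆ W := Finset.filter_subset _ _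
  have h1 : ∑ c ∈ X, E.backing α c < ∑ c ∈ X, E.backing γ c :=
    Finset.sum_lt_sum_of_nonempty ⟨c, Finset.mem_filter.2 ⟨hc, hlt⟩⟩ fun x hx =>
      (Finset.mem_filter.1 hx).2.trans_le (hm x (hXW hx))
  have h2 := hα.isVoteAssignment.sum_mul_backing X fun _ => 1
  have h3 := hγ.sum_mul_backing X fun _ => 1
  simp only [one_mul, mul_one] at h2 h3
  rw [h2, h3] at h1
  refine absurd h1 (not_lt.2 (Finset.sum_le_sum fun v _ => ?_))
  by_cases hv : ∃ d ∈ X, d ∈ E.approves v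
  · obtain ⟨d, hd, hdv⟩ := hv
    have hsum : ∑ c ∈ X, α v c = E.weight v := by
      rw [← hα.sum_eq_weight v d (hXW hd) hdv]
      refine Finset.sum_subset hXW fun c hc hcX => ?_
      refine le_antisymm (not_lt.1 fun hpos => hcX ?_) (hα.isVoteAssignment.nonneg v c)
      exact Finset.mem_filter.2 ⟨hc, (hα.backing_le v c hpos d (hXW hd) hdv).trans_lt
        (Finset.mem_filter.1 hd).2⟩
    rw [hsum]
    exact (Finset.sum_le_sum_of_subset_of_nonneg hXW fun c _ _ => hγ.nonneg v c).trans
      (hγ.le_weight v)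
  · push Not at hv
    rw [Finset.sum_eq_zero fun c hc => hγ.eq_zero fun h => hv c hc h.2]
    exact Finset.sum_nonneg fun c _ => hα.isVoteAssignment.nonneg v c

end Election.IsLocallyBalanced

theorem mul_min_one_div_le {b t : ℝ} (hb : 0 ≤ b) (ht : 0 ≤ t) : b * min 1 (t / b) ≤ t := by
  rcases hb.eq_or_lt with rfl | hb
  · simpa using ht
  · exact (mul_le_mul_of_nonneg_left (min_le_right _ _) hb.le).trans_eq (mul_div_cancel₀ t hb.ne')

theorem le_mul_min_one_div {b t m : ℝ} (hb : 0 ≤ b) (hm : m ≤ b) (ht : m ≤ t) :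
    m ≤ b * min 1 (t / b) := by
  rcases hb.eq_or_lt with rfl | hb
  · simpa using hm
  · rw [mul_min_of_nonneg _ _ hb.le, mul_one, mul_div_cancel₀ t hb.ne']
    exact le_min hm ht

theorem Election.IsVoteAssignment.slack_nonneg (hα : E.IsVoteAssignment W α) (v : V) (t : ℝ) :
    0 ≤ E.slack W α v t :=
  sub_nonneg.2 ((Finset.sum_le_sum fun c _ =>
    mul_le_of_le_one_right (hα.nonneg v c) (min_le_left _ _)).trans (hα.le_weight v))

/-- Giving the candidate `x` a backing weight `t` keeps all backing weights above `m ≤ t`. -/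
theorem Election.IsVoteAssignment.exists_insert (hα : E.IsVoteAssignment W α) {m t : ℝ} {x : C}
    (hm : ∀ c ∈ W, m ≤ E.backing α c) (hx : x ∉ W) (ht : 0 ≤ t) (hmt : m ≤ t)
    (hxt : t ≤ E.prescore W α x t) :
    ∃ γ, E.IsVoteAssignment (insert x W) γ ∧ ∀ c ∈ insert x W, m ≤ E.backing γ c := by
  have hmin0 : ∀ c, 0 ≤ min 1 (t / E.backing α c) := fun c =>
    le_min zero_le_one (div_nonneg ht (hα.backing_nonneg c))
  -- Supporters of `x` scale their shares of members backed by more than `t` and hand the resulting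
  -- slack to `x`; other voters change nothing.
  let γ : V → C → ℝ := fun v c =>
    if x ∈ E.approves v then
      if c = x then E.slack W α v t else α v c * min 1 (t / E.backing α c)
    else α v c
  have hne : ∀ c ∈ W, c ≠ x := fun c hc h => hx (h ▸ hc)
  have hle : ∀ v, ∀ c ∈ W, α v c * min 1 (t / E.backing α c) ≤ γ v c := by
    intro v c hc
    by_cases hv : x ∈ E.approves v
    · simp [γ, hv, hne c hc]
    · simpa [γ, hv] using mul_le_of_le_one_right (hα.nonneg v c) (min_le_left _ _)
  refine ⟨γ, ⟨fun v c => ?_, fun v c h => ?_, fun v => ?_⟩, fun c hc => ?_⟩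
  · simp only [γ]
    split_ifs
    · exact hα.slack_nonneg v t
    · exact mul_nonneg (hα.nonneg v c) (hmin0 c)
    · exact hα.nonneg v c
  · by_cases hcx : c = x ∧ x ∈ E.approves v
    · obtain ⟨rfl, hv⟩ := hcx
      exact ⟨Finset.mem_insert_self _ _, hv⟩
    · have hpos : 0 < α v c := by
        refine (hα.nonneg v c).lt_of_ne fun h0 => ?_
        simp only [γ, ← h0, zero_mul] at h
        split_ifs at h with h1 h2
        · exact hcx ⟨h2, h1⟩
        · exact lt_irrefl _ h
        · exact lt_irrefl _ h
      exact ⟨Finset.mem_insert_of_mem (hα.supported v c hpos).1, (hα.supported v c hpos).2⟩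
  · rw [Finset.sum_insert hx]
    by_cases hv : x ∈ E.approves v
    · have : ∑ c ∈ W, γ v c = ∑ c ∈ W, α v c * min 1 (t / E.backing α c) :=
        Finset.sum_congr rfl fun c hc => by simp [γ, hv, hne c hc]
      rw [this]
      simp [γ, hv, Election.slack]
    · simpa [γ, hv, hα.eq_zero fun h => hv h.2] using hα.le_weight v
  · rcases Finset.mem_insert.1 hc with rfl | hc
    · refine hmt.trans (hxt.trans_eq (Finset.sum_congr rfl fun v hv => ?_))
      simp [γ, mem_supporters.1 hv]
    · refine (le_mul_min_one_div (hα.backing_nonneg c) (hm c hc) hmt).trans ?_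
      rw [Election.backing, Finset.sum_mul]
      exact Finset.sum_le_sum fun v _ => hle v c hc

theorem exists_isBalanced (E : Election C V) (W : Finset C) : ∃ α, E.IsBalanced W α := by
  set K := {α : V → C → ℝ | E.IsVoteAssignment W α} with hK
  have hcont : ∀ c, Continuous fun α : V → C → ℝ => E.backing α c := fun c => by
    unfold Election.backing
    fun_prop
  have hsum : Continuous fun α : V → C → ℝ => ∑ c ∈ W, E.backing α c :=
    continuous_finsetSum _ fun c _ => hcont c
  have hcompact : IsCompact K := by
    have hclosed : IsClosed K := by
      have : K = {α | ∀ v c, 0 ≤ α v c} ∩ ({α | ∀ v c, ¬(c ∈ W ∧ c ∈ E.approves v) → α v c ≤ 0} ∩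
          {α | ∀ v, ∑ c ∈ W, α v c ≤ E.weight v}) := by
        ext α
        refine ⟨fun h => ⟨h.nonneg, fun v c hc => (h.eq_zero hc).le, h.le_weight⟩,
          fun h => ⟨h.1, fun v c hc => ?_, h.2.2⟩⟩
        by_contra h'
        exact (h.2.1 v c h').not_gt hc
      rw [this]
      simp only [Set.ofPred_forall]
      refine IsClosed.inter (isClosed_iInter fun v => isClosed_iInter fun c =>
        isClosed_le (by fun_prop) (by fun_prop)) (IsClosed.inter (isClosed_iInter fun v =>
        isClosed_iInter fun c => isClosed_iInter fun _ => isClosed_le (by fun_prop) (by fun_prop))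
        (isClosed_iInter fun v => isClosed_le (by fun_prop) (by fun_prop)))
    -- `C` may be infinite here; compactness comes from Tychonoff's theorem.
    refine (isCompact_univ_pi fun v => isCompact_univ_pi fun _ : C =>
      isCompact_Icc (a := (0 : ℝ)) (b := E.weight v)).of_isClosed_subset hclosed ?_
    intro α hα v _ c _
    refine ⟨hα.nonneg v c, ?_⟩
    by_cases hc : c ∈ W
    · exact (Finset.single_le_sum (fun c _ => hα.nonneg v c) hc).trans (hα.le_weight v)
    · rw [hα.eq_zero fun h => hc h.1]
      exact E.weight_nonneg v
  have hne : K.Nonempty :=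
    ⟨fun _ _ => 0, fun _ _ => le_rfl, fun _ _ h => absurd h (lt_irrefl _), fun v => by
      simpa using E.weight_nonneg v⟩
  obtain ⟨α₀, hα₀, hmax⟩ := hcompact.exists_isMaxOn hne hsum.continuousOn
  -- The squares are minimised over the compact set of assignments that attain the maximal sum.
  obtain ⟨α, ⟨hα, hα'⟩, hmin⟩ := (hcompact.inter_right (isClosed_eq hsum
    (continuous_const (y := ∑ c ∈ W, E.backing α₀ c)))).exists_isMinOn ⟨α₀, hα₀, rfl⟩
    (continuous_finsetSum W fun c _ => (hcont c).pow 2).continuousOn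
  have hα' : ∑ c ∈ W, E.backing α c = ∑ c ∈ W, E.backing α₀ c := hα'
  exact ⟨α, hα, fun β hβ => hα' ▸ hmax hβ, fun β hβ h => hmin ⟨hβ, h.trans hα'⟩⟩

end Balanced

/-! ### Phragmms in the extended election -/

section Phragmms

variable {C : Type u} {ℓ : ℕ} {W' : Finset (ExtCand ℓ C)} {W : Finset C}

theorem sum_eq_sum_oldCand (hW : ∀ y, oldCand ℓ C y ∈ W' ↔ y ∈ W) {f : ExtCand ℓ C → ℝ}
    (hf : ∀ z, f (newCand ℓ C z) = 0) : ∑ c ∈ W', f c = ∑ y ∈ W, f (oldCand ℓ C y) := by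
  rw [← Finset.sum_map W (oldCand ℓ C) f]
  refine (Finset.sum_subset (fun c hc => ?_) fun c hc hc' => ?_).symm
  · obtain ⟨y, hy, rfl⟩ := Finset.mem_map.1 hc
    exact (hW y).2 hy
  · rcases eq_newCand_or_eq_oldCand c with ⟨z, rfl⟩ | ⟨y, rfl⟩
    · exact hf z
    · exact absurd (Finset.mem_map_of_mem _ ((hW y).1 hc)) hc'

variable {V : Type v} {E : Election C V} {R : Replacement ℓ} {β : Fin R.n ⊕ V → ExtCand ℓ C → ℝ}

theorem apply_inr_newCand (hβ : (E.extend R).IsVoteAssignment W' β) (v : V) (z : Fin ℓ) :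
    β (Sum.inr v) (newCand ℓ C z) = 0 :=
  hβ.eq_zero fun h => newCand_notMem_approves_inr E R z v h.2

theorem apply_inl_oldCand (hβ : (E.extend R).IsVoteAssignment W' β) (v : Fin R.n) (y : C) :
    β (Sum.inl v) (oldCand ℓ C y) = 0 :=
  hβ.eq_zero fun h => oldCand_notMem_approves_inl E R y v h.2

variable [LinearOrder C] [Fintype V]

theorem sum_eq_sum_newCand {f : ExtCand ℓ C → ℝ} (hf : ∀ y, f (oldCand ℓ C y) = 0) :
    ∑ c ∈ W', f c = ∑ z with newCand ℓ C z ∈ W', f (newCand ℓ C z) := by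
  rw [← Finset.sum_map _ (newCand ℓ C) f]
  refine (Finset.sum_subset (fun c hc => ?_) fun c hc hc' => ?_).symm
  · obtain ⟨z, hz, rfl⟩ := Finset.mem_map.1 hc
    exact (Finset.mem_filter.1 hz).2
  · rcases eq_newCand_or_eq_oldCand c with ⟨z, rfl⟩ | ⟨y, rfl⟩
    · exact absurd (Finset.mem_map_of_mem _ (Finset.mem_filter.2 ⟨Finset.mem_univ z, hc⟩)) hc'
    · exact hf y

/-- The part of a vote assignment of the extended election that concerns the old voters. -/
def oldPart (β : Fin R.n ⊕ V → ExtCand ℓ C → ℝ) : V → C → ℝ :=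
  fun v y => β (Sum.inr v) (oldCand ℓ C y)

theorem backing_extend_oldCand (E : Election C V) (β : Fin R.n ⊕ V → ExtCand ℓ C → ℝ) (y : C) :
    (E.extend R).backing β (oldCand ℓ C y) = E.backing (oldPart β) y :=
  sum_supporters_extend_oldCand E R y _

/-- The local conditions speak of one voter and the members it approves, so they restrict to old
voters directly, without a return to the two optimisation problems. -/
theorem isLocallyBalanced_oldPart (hβ : (E.extend R).IsLocallyBalanced W' β)
    (hW : ∀ y, oldCand ℓ C y ∈ W' ↔ y ∈ W) : E.IsLocallyBalanced W (oldPart β) := by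
  have hβ' := hβ.isVoteAssignment
  have hsum : ∀ v, ∑ y ∈ W, oldPart β v y = ∑ c ∈ W', β (Sum.inr v) c := fun v =>
    (sum_eq_sum_oldCand hW (apply_inr_newCand hβ' v)).symm
  refine ⟨⟨fun v y => hβ'.nonneg _ _, fun v y h => ?_, fun v => ?_⟩, fun v d hd hdv => ?_,
    fun v c hc d hd hdv => ?_⟩
  · obtain ⟨h1, h2⟩ := hβ'.supported _ _ h
    exact ⟨(hW y).1 h1, (oldCand_mem_approves_inr E R y v).1 h2⟩
  · rw [hsum]
    exact hβ'.le_weight (Sum.inr v)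
  · rw [hsum]
    exact hβ.sum_eq_weight (Sum.inr v) _ ((hW d).2 hd) ((oldCand_mem_approves_inr E R d v).2 hdv)
  · rw [← backing_extend_oldCand, ← backing_extend_oldCand]
    exact hβ.backing_le _ _ hc _ ((hW d).2 hd) ((oldCand_mem_approves_inr E R d v).2 hdv)

theorem phragmmsScore_extend_oldCand (hβ : (E.extend R).IsLocallyBalanced W' β)
    (hW : ∀ y, oldCand ℓ C y ∈ W' ↔ y ∈ W) {α : V → C → ℝ} (hα : E.IsLocallyBalanced W α)
    (y : C) : (E.extend R).phragmmsScore W' β (oldCand ℓ C y) = E.phragmmsScore W α y := by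
  rw [hα.phragmmsScore_eq (isLocallyBalanced_oldPart hβ hW)]
  have hpre : ∀ t, (E.extend R).prescore W' β (oldCand ℓ C y) t =
      E.prescore W (oldPart β) y t := by
    intro t
    refine (sum_supporters_extend_oldCand E R y _).trans (Finset.sum_congr rfl fun v _ => ?_)
    rw [Election.slack, Election.slack, sum_eq_sum_oldCand hW fun z => by
      rw [apply_inr_newCand hβ.isVoteAssignment, zero_mul]]
    simp only [backing_extend_oldCand]
    rfl
  simp only [Election.phragmmsScore, hpre]

theorem le_phragmmsScore {C : Type u} {V : Type v} [LinearOrder C] [Fintype V] {E : Election C V}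
    {W : Finset C} {α : V → C → ℝ} (hα : E.IsVoteAssignment W α) {x : C} {m : ℝ} (hm : 0 ≤ m)
    (h : m ≤ E.prescore W α x m) : m ≤ E.phragmmsScore W α x :=
  (E.isGreatest_phragmmsScore hα x).2 ⟨hm, h⟩

/-- Scaled to threshold `m`, each elected new candidate uses at most `m` of the voter's weight `ℓ *
m`. At most `ℓ - 1` are elected, so `m` is left for `z`. -/
theorem le_phragmmsScore_oneVoter {m : ℝ} (hm : 0 ≤ m) (hz : 0 ≤ ℓ * m)
    {β : Fin (Replacement.oneVoter ℓ _ hz).n ⊕ V → ExtCand ℓ C → ℝ}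
    (hβ : (E.extend (Replacement.oneVoter ℓ _ hz)).IsVoteAssignment W' β) {z : Fin ℓ}
    (hzW : newCand ℓ C z ∉ W') :
    m ≤ (E.extend (Replacement.oneVoter ℓ _ hz)).phragmmsScore W' β (newCand ℓ C z) := by
  refine le_phragmmsScore hβ hm ?_
  refine le_of_le_of_eq ?_ (sum_supporters_oneVoter E hz z _).symm
  rw [Election.slack, sum_eq_sum_newCand fun y =>
    mul_eq_zero_of_left (apply_inl_oldCand hβ _ y) _]
  have hback : ∀ z, (E.extend (Replacement.oneVoter ℓ _ hz)).backing β (newCand ℓ C z) =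
      β (Sum.inl (0 : Fin 1)) (newCand ℓ C z) := fun z => sum_supporters_oneVoter E hz z _
  have hcard : (Finset.univ.filter fun z => newCand ℓ C z ∈ W').card + 1 ≤ ℓ := by
    have := Finset.card_lt_univ_of_notMem (s := Finset.univ.filter fun z => newCand ℓ C z ∈ W')
      (x := z) (by simpa using hzW)
    rwa [Fintype.card_fin] at this
  have hsum := Finset.sum_le_card_nsmul (Finset.univ.filter fun z => newCand ℓ C z ∈ W')
    (fun z => β (Sum.inl (0 : Fin 1)) (newCand ℓ C z) *
      min 1 (m / (E.extend (Replacement.oneVoter ℓ _ hz)).backing β (newCand ℓ C z))) m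
    fun z _ => by
      rw [hback]
      exact mul_min_one_div_le (hβ.nonneg _ _) hm
  rw [nsmul_eq_mul] at hsum
  have hcard' : ((Finset.univ.filter fun z => newCand ℓ C z ∈ W').card : ℝ) + 1 ≤ ℓ := by
    exact_mod_cast hcard
  have hmul := mul_le_mul_of_nonneg_right hcard' hm
  have hweight : (E.extend (Replacement.oneVoter ℓ _ hz)).weight (Sum.inl (0 : Fin 1)) = ℓ * m :=
    rfl
  rw [hweight]
  linarith

/-- The voter approving `z` approves no committee member, so its entire weight `m` is free. -/
theorem le_phragmmsScore_oneVoterEach {m : ℝ} (hm : 0 ≤ m)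
    {β : Fin (Replacement.oneVoterEach ℓ m hm).n ⊕ V → ExtCand ℓ C → ℝ}
    (hβ : (E.extend (Replacement.oneVoterEach ℓ m hm)).IsVoteAssignment W' β) {z : Fin ℓ}
    (hzW : newCand ℓ C z ∉ W') :
    m ≤ (E.extend (Replacement.oneVoterEach ℓ m hm)).phragmmsScore W' β (newCand ℓ C z) := by
  refine le_phragmmsScore hβ hm ?_
  refine le_of_le_of_eq ?_ (sum_supporters_oneVoterEach E hm z _).symm
  rw [Election.slack, Finset.sum_eq_zero fun c hc => ?_, sub_zero]
  · exact le_rfl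
  · rw [hβ.eq_zero, zero_mul]
    rintro ⟨-, h⟩
    obtain ⟨z', hz', rfl⟩ := Finset.mem_map.1 h
    obtain rfl : z' = z := Finset.mem_singleton.1 hz'
    exact hzW hc

/-! ### Comparison of Phragmms runs and the cost bounds -/

section Run

variable {c : ℕ → C} {α : ℕ → V → C → ℝ} {d : ℕ → ExtCand ℓ C}
  {β : ℕ → Fin R.n ⊕ V → ExtCand ℓ C → ℝ}

theorem IsPhragmmsRun.isLocallyBalanced (hc : IsPhragmmsRun E c α) {i : ℕ} (hi : i < E.k) :
    E.IsLocallyBalanced (electedSet c i) (α i) :=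
  (hc.1 i hi).isLocallyBalanced

theorem IsPhragmmsRun.electionScore_nonneg (hc : IsPhragmmsRun E c α) {i : ℕ} (hi : i < E.k) :
    0 ≤ E.electionScore c α i :=
  (E.isGreatest_phragmmsScore (hc.1 i hi).isVoteAssignment (c i)).1.1

theorem IsPhragmmsRun.score_oldCand (hc : IsPhragmmsRun E c α)
    (hd : IsPhragmmsRun (E.extend R) d β) {i : ℕ} (hi : i < E.k) (hf : Follows d c i) (y : C) :
    (E.extend R).phragmmsScore (electedSet d i) (β i) (oldCand ℓ C y) =
      E.phragmmsScore (electedSet c (oldCount d i)) (α (oldCount d i)) y :=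
  phragmmsScore_extend_oldCand (hd.isLocallyBalanced hi) hf.mem_iff
    (hc.isLocallyBalanced ((oldCount_le d i).trans_lt hi)) y

theorem IsPhragmmsRun.follows (hc : IsPhragmmsRun E c α) (hd : IsPhragmmsRun (E.extend R) d β) :
    Follows d c E.k :=
  IsGreedyRun.follows hd.2 hc.2 fun _ hi hf y => hc.score_oldCand hd hi hf y

theorem IsPhragmmsRun.exists_extend [Finite C] (hc : IsPhragmmsRun E c α) (R : Replacement ℓ) :
    ∃ d β, IsPhragmmsRun (E.extend R) d β := by
  have : Nonempty (ExtCand ℓ C) := ⟨oldCand ℓ C (c 0)⟩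
  -- Fixing one balanced assignment per committee makes the score a function of the committee, as
  -- `exists_isGreedyRun` requires.
  choose A hA using exists_isBalanced (E.extend R)
  obtain ⟨d, hd⟩ := exists_isGreedyRun (le_card_extCand fun i hi => (hc.2 i hi).1)
    fun W => (E.extend R).phragmmsScore W (A W)
  exact ⟨d, fun i => A (electedSet d i), fun i _ => hA _, hd⟩

/-- If all candidates are elected with scores at least `m`, then the committee has a vote
assignment with all backing weights at least `m`. -/
theorem IsPhragmmsRun.exists_le_backing (hc : IsPhragmmsRun E c α) {m : ℝ}
    (hm : ∀ i < E.k, m ≤ E.electionScore c α i) {i : ℕ} (hi : i ≤ E.k) :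
    ∃ γ, E.IsVoteAssignment (electedSet c i) γ ∧ ∀ x ∈ electedSet c i, m ≤ E.backing γ x := by
  induction i with
  | zero =>
    refine ⟨fun _ _ => 0, ⟨fun _ _ => le_rfl, fun _ _ h => absurd h (lt_irrefl _), fun v => ?_⟩, ?_⟩
    · simpa using E.weight_nonneg v
    · simp [electedSet_zero]
  | succ i ih =>
    obtain ⟨γ, hγ, hγm⟩ := ih (by omega)
    have hloc := hc.isLocallyBalanced (i := i) (by omega)
    obtain ⟨h0, hs⟩ := (E.isGreatest_phragmmsScore hloc.isVoteAssignment (c i)).1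
    rw [electedSet_succ]
    -- The bound passes from `γ` to the run's own balanced assignment, which maximises the minimum
    -- backing; the score of `c i` refers to that assignment.
    exact hloc.isVoteAssignment.exists_insert (hloc.le_backing hγ hγm) (hc.2 i (by omega)).1 h0
      (hm i (by omega)) hs

theorem le_totalWeight_of_backing {W' : Finset (ExtCand ℓ C)}
    {γ : Fin R.n ⊕ V → ExtCand ℓ C → ℝ} (hγ : (E.extend R).IsVoteAssignment W' γ)
    (hmem : ∀ z, newCand ℓ C z ∈ W') {m : ℝ}
    (hm : ∀ z, m ≤ (E.extend R).backing γ (newCand ℓ C z)) : ℓ * m ≤ R.totalWeight := by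
  have h1 := Finset.card_nsmul_le_sum Finset.univ _ _ fun z _ => hm z
  rw [Finset.card_univ, Fintype.card_fin, nsmul_eq_mul] at h1
  refine h1.trans ?_
  have h2 : ∀ z, (E.extend R).backing γ (newCand ℓ C z) =
      ∑ v, γ (Sum.inl v) (newCand ℓ C z) := fun z => by
    rw [hγ.backing_eq, Fintype.sum_sum_type]
    simp [apply_inr_newCand hγ]
  simp only [h2]
  rw [Finset.sum_comm]
  refine Finset.sum_le_sum fun v _ => ?_
  refine le_trans ?_ (hγ.le_weight (Sum.inl v))
  rw [sum_eq_sum_newCand (apply_inl_oldCand hγ v)]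
  simp [hmem]

/-- In every round, whether its winner is old or new, the next old candidate is available with its
original score, at least `m`. So all winning scores are at least `m`, and so are all backings in a
suitable assignment. -/
theorem IsPhragmmsRun.le_totalWeight (hc : IsPhragmmsRun E c α)
    (hd : IsPhragmmsRun (E.extend R) d β) (hℓ : 1 ≤ ℓ) (hℓk : ℓ ≤ E.k)
    (hmem : ∀ z, newCand ℓ C z ∈ electedSet d E.k) {m : ℝ}
    (hm : ∀ i ≤ E.k - ℓ, m ≤ E.electionScore c α i) : ℓ * m ≤ R.totalWeight := by
  have hf := hc.follows hd
  have hscore : ∀ i < (E.extend R).k, m ≤ (E.extend R).electionScore d β i := by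
    intro i hi
    have hi : i < E.k := hi
    have ho : oldCount d i ≤ E.k - ℓ := (oldCount_mono d hi.le).trans_eq
      (oldCount_eq_of_forall_mem (n := E.k) (fun i hi => (hd.2 i hi).1) hmem)
    refine (hm _ ho).trans ?_
    rw [Election.electionScore, ← hc.score_oldCand hd hi (hf.mono hi.le)]
    have h := (hd.2 i hi).2 _ ((hf.mono hi.le).oldCand_notMem (fun i hi => (hc.2 i hi).1)
      (by omega : oldCount d i < E.k) le_rfl)
    exact h.elim le_of_lt fun h => h.1.le
  obtain ⟨γ, hγ, hγm⟩ := hd.exists_le_backing hscore (i := E.k) le_rfl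
  exact le_totalWeight_of_backing hγ hmem fun z => hγm _ (hmem z)

/-- It suffices that new candidates match the score of a single `c p` with `p ≤ k - ℓ`, since a
missing one would have lost to `c p`. This is why the minimum score sets the price. -/
theorem IsPhragmmsRun.successful [Finite C] (hc : IsPhragmmsRun E c α) (hℓk : ℓ ≤ E.k) {p : ℕ}
    (hp : p ≤ E.k - ℓ)
    (hnew : ∀ W' β, (E.extend R).IsVoteAssignment W' β → ∀ z, newCand ℓ C z ∉ W' →
      E.electionScore c α p ≤ (E.extend R).phragmmsScore W' β (newCand ℓ C z)) :
    R.Successful Phragmms E := by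
  obtain ⟨d, β, hd⟩ := hc.exists_extend R
  have hf := hc.follows hd
  refine ⟨_, ⟨d, β, hd, rfl⟩, IsGreedyRun.newCand_mem hd.2 hf hℓk hp (fun i hi ho => ?_)
    fun i hi z hz => hnew _ _ (hd.1 i hi).isVoteAssignment z hz⟩
  have hi : i < E.k := hi
  rw [hc.score_oldCand hd hi (hf.mono hi.le), ho]
  exact le_rfl

end Run

theorem phragmms_successful_oneVoter [Finite C] {c : ℕ → C} {α : ℕ → V → C → ℝ}
    (hc : IsPhragmmsRun E c α) (hℓk : ℓ ≤ E.k) {p : ℕ} (hp : p ≤ E.k - ℓ)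
    (h0 : 0 ≤ E.electionScore c α p) (hz : 0 ≤ ℓ * E.electionScore c α p) :
    (Replacement.oneVoter ℓ _ hz).Successful Phragmms E :=
  hc.successful (R := Replacement.oneVoter ℓ _ hz) hℓk hp fun _ _ hβ _ hzW =>
    le_phragmmsScore_oneVoter h0 hz hβ hzW

theorem phragmms_successful_oneVoterEach [Finite C] {c : ℕ → C} {α : ℕ → V → C → ℝ}
    (hc : IsPhragmmsRun E c α) (hℓk : ℓ ≤ E.k) {p : ℕ} (hp : p ≤ E.k - ℓ)
    (h0 : 0 ≤ E.electionScore c α p) :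
    (Replacement.oneVoterEach ℓ _ h0).Successful Phragmms E :=
  hc.successful (R := Replacement.oneVoterEach ℓ _ h0) hℓk hp fun _ _ hβ _ hzW =>
    le_phragmmsScore_oneVoterEach h0 hβ hzW

theorem isMinExogenousCost_phragmms [Finite C] {c : ℕ → C} {α : ℕ → V → C → ℝ}
    (hc : IsPhragmmsRun E c α) (hℓ : 1 ≤ ℓ) (hℓk : ℓ ≤ E.k) {p : ℕ} (hp : p ≤ E.k - ℓ)
    (hmin : ∀ i ≤ E.k - ℓ, E.electionScore c α p ≤ E.electionScore c α i) :
    IsMinExogenousCost Phragmms E ℓ (ℓ * E.electionScore c α p) := by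
  refine ⟨⟨_, phragmms_successful_oneVoterEach hc hℓk hp
    (hc.electionScore_nonneg (by omega)), totalWeight_oneVoterEach _ _⟩, ?_⟩
  rintro _ ⟨R, ⟨_, ⟨d, β, hd, rfl⟩, hmem⟩, rfl⟩
  exact hc.le_totalWeight hd hℓ hℓk hmem hmin

end Phragmms

end ABCVoting

theorem theorem1 :
    -- Approval Voting: the approval weight of the candidate selected in round `k - ℓ + 1`
    (∃ P : ArithProgram 2, P.steps ≤ 3 ∧
      ∀ {C : Type u} {V : Type v} [Finite C] [LinearOrder C] [Fintype V]
        (E : Election C V) (ℓ : ℕ), 1 ≤ ℓ → ℓ ≤ E.k →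
        ∀ c : ℕ → C, IsAVRun E c →
        ∀ x : ℝ, x = E.approvalWeight (c (E.k - ℓ)) →
          P.eval ![(ℓ : ℝ), x] = x ∧
          IsMinExogenousCost AV E ℓ x ∧
          ∃ hx : 0 ≤ x, (Replacement.oneVoter ℓ x hx).Successful AV E) ∧
    -- Satisfaction Approval Voting: `ℓ` times the score of the candidate of round `k - ℓ + 1`
    (∃ P : ArithProgram 2, P.steps ≤ 3 ∧
      ∀ {C : Type u} {V : Type v} [Finite C] [LinearOrder C] [Fintype V]
        (E : Election C V) (ℓ : ℕ), 1 ≤ ℓ → ℓ ≤ E.k →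
        ∀ c : ℕ → C, IsSAVRun E c →
        ∀ x : ℝ, x = E.savScore (c (E.k - ℓ)) →
          P.eval ![(ℓ : ℝ), x] = ℓ * x ∧
          IsMinExogenousCost SAV E ℓ (ℓ * x) ∧
          ∃ hx : 0 ≤ x, (Replacement.oneVoterEach ℓ x hx).Successful SAV E) ∧
    -- seq-Phragmén: `ℓ / τ`, where `τ` is the time at which round `k - ℓ + 1` takes place
    (∃ P : ArithProgram 2, P.steps ≤ 3 ∧
      ∀ {C : Type u} {V : Type v} [Finite C] [LinearOrder C] [Fintype V]
        (E : Election C V) (ℓ : ℕ), 1 ≤ ℓ → ℓ ≤ E.k →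
        ∀ (c : ℕ → C) (t : ℕ → ℝ), IsSeqPhragmenRun E c t →
        ∀ τ : ℝ, τ = t (E.k - ℓ) →
          0 < τ ∧
          P.eval ![(ℓ : ℝ), τ] = ℓ / τ ∧
          IsMinExogenousCost SeqPhragmen E ℓ (ℓ / τ) ∧
          ∃ hx : 0 ≤ 1 / τ, (Replacement.oneVoterEach ℓ (1 / τ) hx).Successful SeqPhragmen E) ∧
    -- Phragmms: `ℓ` times the minimum of the scores of the candidates of the first
    -- `k - ℓ + 1` rounds at the moments of their selection
    (∃ P : ArithProgram 2, P.steps ≤ 3 ∧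
      ∀ {C : Type u} {V : Type v} [Finite C] [LinearOrder C] [Fintype V]
        (E : Election C V) (ℓ : ℕ), 1 ≤ ℓ → ℓ ≤ E.k →
        ∀ (c : ℕ → C) (α : ℕ → V → C → ℝ), IsPhragmmsRun E c α →
        ∀ s : ℝ, s = (Finset.range (E.k - ℓ + 1)).inf' Finset.nonempty_range_add_one
            (E.electionScore c α) →
          P.eval ![(ℓ : ℝ), s] = ℓ * s ∧
          IsMinExogenousCost Phragmms E ℓ (ℓ * s) ∧
          (∃ hz : 0 ≤ ℓ * s, (Replacement.oneVoter ℓ (ℓ * s) hz).Successful Phragmms E) ∧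
          ∃ hs : 0 ≤ s, (Replacement.oneVoterEach ℓ s hs).Successful Phragmms E) := by
  refine ⟨⟨.input 1, by simp [ArithProgram.steps], ?_⟩,
    ⟨.mul (.input 0) (.input 1), by simp [ArithProgram.steps], ?_⟩,
    ⟨.div (.input 0) (.input 1), by simp [ArithProgram.steps], ?_⟩,
    ⟨.mul (.input 0) (.input 1), by simp [ArithProgram.steps], ?_⟩⟩
  · rintro C V _ _ _ E ℓ hℓ hℓk c hc _ rfl
    exact ⟨rfl, isMinExogenousCost_av hc hℓ hℓk, _, av_successful_oneVoter hc hℓk⟩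
  · rintro C V _ _ _ E ℓ hℓ hℓk c hc _ rfl
    exact ⟨rfl, isMinExogenousCost_sav hc hℓ hℓk, _, sav_successful_oneVoterEach hc hℓk⟩
  · rintro C V _ _ _ E ℓ hℓ hℓk c t hc _ rfl
    have hpos : 0 < t (E.k - ℓ) := seqPhragmen_time_pos hc (by omega)
    exact ⟨hpos, rfl, isMinExogenousCost_seqPhragmen hc hℓ hℓk, (one_div_pos.2 hpos).le,
      seqPhragmen_successful_oneVoterEach hc hℓk _ (one_div_mul_cancel hpos.ne')⟩
  · rintro C V _ _ _ E ℓ hℓ hℓk c α hc _ rfl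
    obtain ⟨p, hp, hps⟩ := Finset.exists_mem_eq_inf' (s := Finset.range (E.k - ℓ + 1))
      Finset.nonempty_range_add_one (E.electionScore c α)
    have hp : p ≤ E.k - ℓ := Nat.lt_succ_iff.1 (Finset.mem_range.1 hp)
    have hmin : ∀ i ≤ E.k - ℓ, E.electionScore c α p ≤ E.electionScore c α i := fun i hi =>
      hps ▸ Finset.inf'_le _ (Finset.mem_range.2 (Nat.lt_succ_of_le hi))
    have h0 : 0 ≤ E.electionScore c α p := hc.electionScore_nonneg (by omega)
    have hz : 0 ≤ ℓ * E.electionScore c α p := mul_nonneg (Nat.cast_nonneg _) h0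
    simp only [hps]
    exact ⟨rfl, isMinExogenousCost_phragmms hc hℓ hℓk hp hmin,
      ⟨hz, phragmms_successful_oneVoter hc hℓk hp h0 hz⟩,
      h0, phragmms_successful_oneVoterEach hc hℓk hp h0⟩
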